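/- **Setting.** Let $k$ be a commutative ring. A *double algebra* is a $k$-module $A$ with two associative unital $k$-algebra structures $V=\langle A,\circ,e\rangle$ (vertical) and $H=\langle A,\star,i\rangle$ (horizontal) such that, with $\Phi_L(a)=a\star e$, $\Phi_R(a)=e\star a$, $\Phi_B(a)=a\circ i$, $\Phi_T(a)=i\circ a$, one has for all $a,b\in A$ $$\begin{aligned} \Phi_L(a)\circ b&=\Phi_B\Phi_L(a)\star b, & a\circ\Phi_L(b)&=\Phi_T\Phi_L(b)\star a, & \Phi_B(a)\star b&=\Phi_L\Phi_B(a)\circ b, & a\star\Phi_B(b)&=\Phi_R\Phi_B(b)\circ a,\\ a\circ\Phi_R(b)&=a\star\Phi_T\Phi_R(b), & \Phi_R(a)\circ b&=b\star\Phi_B\Phi_R(a), & a\star\Phi_T(b)&=a\circ\Phi_R\Phi_T(b), & \Phi_T(a)\star b&=b\circ\Phi_L\Phi_T(a). \end{aligned}$$ The images $L=\Phi_L(A)$, $R=\Phi_R(A)$ are subalgebras of $V$, and $B=\Phi_B(A)$, $T=\Phi_T(A)$ are subalgebras of $H$. For an algebra map $\iota:X\to S$, a *Frobenius homomorphism* is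 a $k$-linear $X$-$X$-bimodule map $F:S\to X$ for which there are finitely many $x_j,y_j\in S$ with $\sum_j\iota(F(ax_j))y_j=a=\sum_jx_j\iota(F(y_ja))$ for all $a\in S$ (a dual basis). $A$ is *Frobenius* if $\Phi_L,\Phi_R:V\to L,R$ and $\Phi_B,\Phi_T:H\to B,T$ are Frobenius homomorphisms. An *antipode* is a $k$-linear map $S:A\to A$ with $\Phi_B(a'\star(a''\circ a))=\Phi_B((a'\circ S(a))\star a'')$, $\Phi_R(a'\circ(a\star a''))=\Phi_R((S(a)\star a')\circ a'')$, $\Phi_L((a'\star a)\circ a'')=\Phi_L(a'\circ(a''\star S(a)))$, $\Phi_T((a\circ a')\star a'')=\Phi_T(a'\star(S(a)\circ a''))$ for all $a,a',a''\in A$. A *left (right) almost bialgebroid* $\langle\mathcal A,\mathcal B,s,t,\Delta,\varepsilon\rangle$ satisfies all axioms of a left (right) bialgebroid except possibly multiplicativity of $\Delta$. A Frobenius double algebra has the left almost bialgebroids $V_B=\langle V,B,\Phi_L|_B,\Phi_R|_B,\Delta_B,\Phi_B\rangle$, $H_L=\langle H,L,\Phi_B|_L,\Phi_T|_L,\Delta_L,\Phi_L\rangle$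 and the right almost bialgebroids $V_T=\langle V,T,\Phi_R|_T,\Phi_L|_T,\Delta_T,\Phi_T\rangle$, $H_R=\langle H,R,\Phi_T|_R,\Phi_B|_R,\Delta_R,\Phi_R\rangle$, where $\Delta_X(a)=\sum_j a x_j\otimes_X y_j$ for the dual basis $\sum_jx_j\otimes_X y_j$ of $\Phi_X$ (product $\star$ for $X=B,T$ and $\circ$ for $X=L,R$). For a left almost bialgebroid let $\mathcal A^{r}=\{\varphi\in\mathrm{Hom}_k(\mathcal A,\mathcal B):\varphi(s(b)a)=b\varphi(a)\}$, with product $(\varphi\psi)(a)=\psi(t(\varphi(a_{(2)}))a_{(1)})$, unit $\varepsilon$ and source map $\hat s(b)=\varepsilon(\_)\,b$. A *Frobenius left integral in* $\mathcal A$ is an $x\in\mathcal A$ with $ax=s(\varepsilon(a))x$ for all $a\in\mathcal A$ such that $\varphi\mapsto\varphi(x)$, $\mathcal A^r\to\mathcal B$, is a Frobenius homomorphism for $\hat s$. A *Frobenius right integral on* $\mathcal A$ is a $\rho\in\mathcal A^r$ with $\rho\psi=\rho\,\hat s(\psi(1))$ for all $\psi\in\mathcal A^r$ which is a Frobenius homomorphism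 for $s$. The *dual left integral* of $\rho$ is the $x\in\mathcal A$ with $\rho(ax)=\varepsilon(a)$ for all $a\in\mathcal A$; the *dual right integral* of $x$ is the $\rho\in\mathcal A^r$ with $(\rho\psi)(x)=\psi(1)$ for all $\psi\in\mathcal A^r$. For a right almost bialgebroid the notions are the mirror images: $\mathcal A^{l}=\{\varphi:\varphi(as(b))=\varphi(a)b\}$ with product $(\varphi\psi)(a)=\varphi(a^{(2)}t(\psi(a^{(1)})))$ and source map $b\mapsto b\,\varepsilon(\_)$; a Frobenius right integral $x$ in $\mathcal A$ satisfies $xa=x\,s(\varepsilon(a))$ and evaluation $\mathcal A^l\to\mathcal B$ at $x$ is a Frobenius homomorphism for this source map; a Frobenius left integral $\rho\in\mathcal A^l$ on $\mathcal A$ satisfies $\psi\rho=\psi(1)\varepsilon(\_)\cdot\rho$ and is a Frobenius homomorphism for $s$; duality is $\rho(xa)=\varepsilon(a)$ for all $a$, respectively $(\psi\rho)(x)=\psi(1)$ for all $\psi$. Let $T_\star,B_\star$ be the sets of elements of $T,B$ that are invertible in $H$, and $R_\circ,L_\circ$ the sets of elements of $R,L$ that are invertible in $V$. Inverses of elements of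 $T_\star,B_\star$ are taken in $H$, those of $R_\circ,L_\circ$ in $V$. **Lemma.** Let $A$ be a Frobenius double algebra. 1. The Frobenius left integrals in $V_B$ are exactly the elements of $T_\star$; the Frobenius right integrals in $V_T$ are exactly the elements of $B_\star$. 2. The Frobenius left integrals in $H_L$ are exactly the elements of $R_\circ$; the Frobenius right integrals in $H_R$ are exactly the elements of $L_\circ$. Suppose moreover that $A$ has an antipode. 3. $t\mapsto\Phi_R(t^{-1})$ is a bijection $T_\star\to R_\circ$ with inverse bijection $r\mapsto\Phi_T(r^{-1})$. It is the duality of Frobenius integrals: $r\mapsto\rho_r:=\Phi_B\Phi_L(\_\circ r)$ is a bijection from $R_\circ$ onto the set of Frobenius right integrals on $V_B$; for $r\in R_\circ$ the dual left integral of $\rho_r$ is $\Phi_T(r^{-1})$ (and only this element); for $t\in T_\star$ the dual right integral of $t$ is $\rho_r$ with $r=\Phi_R(t^{-1})$ (and only this functional). 4. $b\mapsto\Phi_L(b^{-1})$ is a bijection $B_\star\to L_\circ$ with inverse bijection $l\mapsto\Phi_B(l^{-1})$. It is the duality of Frobenius integrals: $l\mapsto\lambda_l:=\Phi_T\Phi_R(l\circ\_)$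 is a bijection from $L_\circ$ onto the set of Frobenius left integrals on $V_T$; for $l\in L_\circ$ the dual right integral of $\lambda_l$ is $\Phi_B(l^{-1})$ (and only this element); for $b\in B_\star$ the dual left integral of $b$ is $\lambda_l$ with $l=\Phi_L(b^{-1})$ (and only this functional). -/

import Mathlib

open scoped TensorProduct
open MulOpposite (op)

noncomputable section

/-! ### Bimodules and tensor products over a noncommutative `k`-algebra, corings -/

section Bimodules

variable {k B M N P : Type*} [CommRing k] [Ring B] [Algebra k B]
  [AddCommGroup M] [Module k M] [AddCommGroup N] [Module k N] [AddCommGroup P] [Module k P]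

/-- A `B`-`B`-bimodule structure on the `k`-module `M`: `l b m` is `b · m`, `r (op b) m` is
`m · b`. -/
structure BimoduleStr (k B M : Type*) [CommRing k] [Ring B] [Algebra k B]
    [AddCommGroup M] [Module k M] where
  l : B →ₐ[k] Module.End k M
  r : Bᵐᵒᵖ →ₐ[k] Module.End k M
  comm : ∀ b c m, l b (r c m) = r c (l b m)

namespace BimoduleStr

variable (X : BimoduleStr k B M) (Y : BimoduleStr k B N)

/-- The relations `m · b ⊗ n = m ⊗ b · n`. -/
def relations : Submodule k (M ⊗[k] N) :=
  Submodule.span k {z | ∃ m b n, z = X.r (op b) m ⊗ₜ[k] n - m ⊗ₜ[k] Y.l b n}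

/-- The tensor product `M ⊗_B N` over the (noncommutative) algebra `B`. -/
def Tensor : Type _ := (M ⊗[k] N) ⧸ X.relations Y

instance : AddCommGroup (X.Tensor Y) :=
  inferInstanceAs (AddCommGroup ((M ⊗[k] N) ⧸ X.relations Y))

instance : Module k (X.Tensor Y) :=
  inferInstanceAs (Module k ((M ⊗[k] N) ⧸ X.relations Y))

/-- `tmk m n` is the class of `m ⊗ n` in `M ⊗_B N`. -/
def tmk : M →ₗ[k] N →ₗ[k] X.Tensor Y :=
  (TensorProduct.mk k M N).compr₂ (X.relations Y).mkQ

theorem tmk_balanced (m : M) (b : B) (n : N) :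
    X.tmk Y (X.r (op b) m) n = X.tmk Y m (Y.l b n) := by
  have h : X.r (op b) m ⊗ₜ[k] n - m ⊗ₜ[k] Y.l b n ∈ X.relations Y :=
    Submodule.subset_span ⟨m, b, n, rfl⟩
  exact (Submodule.Quotient.eq (X.relations Y)).mpr h

/-- The universal property of `M ⊗_B N`. -/
def lift (f : M →ₗ[k] N →ₗ[k] P) (hf : ∀ m b n, f (X.r (op b) m) n = f m (Y.l b n)) :
    X.Tensor Y →ₗ[k] P :=
  (X.relations Y).liftQ (TensorProduct.lift f) (by
    refine Submodule.span_le.mpr ?_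
    rintro _ ⟨m, b, n, rfl⟩
    simp [hf])

@[simp] theorem lift_tmk (f : M →ₗ[k] N →ₗ[k] P)
    (hf : ∀ m b n, f (X.r (op b) m) n = f m (Y.l b n)) (m : M) (n : N) :
    X.lift Y f hf (X.tmk Y m n) = f m n :=
  TensorProduct.lift.tmul m n

theorem hom_ext {f g : X.Tensor Y →ₗ[k] P} (h : ∀ m n, f (X.tmk Y m n) = g (X.tmk Y m n)) :
    f = g :=
  Submodule.linearMap_qext _ (TensorProduct.ext' h)

/-- `f ⊗ g` for a right `B`-linear `f` and a left `B`-linear `g`. -/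
def map (f : Module.End k M) (g : Module.End k N)
    (hf : ∀ b m, f (X.r (op b) m) = X.r (op b) (f m))
    (hg : ∀ b n, g (Y.l b n) = Y.l b (g n)) : Module.End k (X.Tensor Y) :=
  X.lift Y ((X.tmk Y).compl₁₂ f g) (by
    intro m b n
    simp [hf, hg, tmk_balanced])

@[simp] theorem map_tmk (f : Module.End k M) (g : Module.End k N)
    (hf : ∀ b m, f (X.r (op b) m) = X.r (op b) (f m))
    (hg : ∀ b n, g (Y.l b n) = Y.l b (g n)) (m : M) (n : N) :
    X.map Y f g hf hg (X.tmk Y m n) = X.tmk Y (f m) (g n) := by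
  simp [map]

/-- The bimodule structure `b · (m ⊗ n) · c = (b · m) ⊗ (n · c)` on `M ⊗_B N`. -/
def tensorStr : BimoduleStr k B (X.Tensor Y) where
  l := AlgHom.ofLinearMap
    { toFun := fun b => X.map Y (X.l b) 1 (fun c m => X.comm b (op c) m) (fun _ _ => rfl)
      map_add' := fun b c => X.hom_ext Y (by simp)
      map_smul' := fun x b => X.hom_ext Y (by simp) }
    (X.hom_ext Y (by simp)) (fun b c => X.hom_ext Y (by simp))
  r := AlgHom.ofLinearMap
    { toFun := fun c => X.map Y 1 (Y.r c) (fun _ _ => rfl) (fun b n => (Y.comm b c n).symm)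
      map_add' := fun b c => X.hom_ext Y (by simp)
      map_smul' := fun x b => X.hom_ext Y (by simp) }
    (X.hom_ext Y (by simp)) (fun b c => X.hom_ext Y (by simp))
  comm := fun b c z => by
    have : (X.map Y (X.l b) 1 (fun c m => X.comm b (op c) m) (fun _ _ => rfl)) ∘ₗ
        (X.map Y 1 (Y.r c) (fun _ _ => rfl) (fun b n => (Y.comm b c n).symm)) =
        (X.map Y 1 (Y.r c) (fun _ _ => rfl) (fun b n => (Y.comm b c n).symm)) ∘ₗ
        (X.map Y (X.l b) 1 (fun c m => X.comm b (op c) m) (fun _ _ => rfl)) :=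
      X.hom_ext Y (by simp)
    exact LinearMap.congr_fun this z

@[simp] theorem tensorStr_l (b : B) (m : M) (n : N) :
    (X.tensorStr Y).l b (X.tmk Y m n) = X.tmk Y (X.l b m) n := by
  simp [tensorStr]

@[simp] theorem tensorStr_r (b : Bᵐᵒᵖ) (m : M) (n : N) :
    (X.tensorStr Y).r b (X.tmk Y m n) = X.tmk Y m (Y.r b n) := by
  simp [tensorStr]

/-- For `n : M`, the map `x ⊗ y ↦ x ⊗ (y ⊗ n)` from `M ⊗_B M` to `M ⊗_B (M ⊗_B M)`. -/
def assocRight : M →ₗ[k] X.Tensor X →ₗ[k] X.Tensor (X.tensorStr X) :=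
  (X.lift X (P := M →ₗ[k] X.Tensor (X.tensorStr X))
    (LinearMap.mk₂ k (fun x y => X.tmk (X.tensorStr X) x ∘ₗ X.tmk X y)
      (fun _ _ _ => by ext; simp) (fun _ _ _ => by ext; simp)
      (fun _ _ _ => by ext; simp) (fun _ _ _ => by ext; simp))
    (by
      intro m b y
      ext n
      simp [tmk_balanced])).flip

@[simp] theorem assocRight_tmk (x y n : M) :
    X.assocRight n (X.tmk X x y) = X.tmk (X.tensorStr X) x (X.tmk X y n) := by
  simp [assocRight]

theorem assocRight_r (b : B) (n : M) (z : X.Tensor X) :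
    X.assocRight n ((X.tensorStr X).r (op b) z) = X.assocRight (X.l b n) z := by
  have : (X.assocRight n) ∘ₗ ((X.tensorStr X).r (op b)) = X.assocRight (X.l b n) :=
    X.hom_ext X (by simp [tmk_balanced])
  exact LinearMap.congr_fun this z

/-- `id ⊗ Δ : M ⊗_B M → M ⊗_B (M ⊗_B M)` for a left `B`-linear `Δ`. -/
def idTensor (Δ : M →ₗ[k] X.Tensor X) (h : ∀ b m, Δ (X.l b m) = (X.tensorStr X).l b (Δ m)) :
    X.Tensor X →ₗ[k] X.Tensor (X.tensorStr X) :=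
  X.lift X ((X.tmk (X.tensorStr X)).compl₁₂ LinearMap.id Δ) (by
    intro m b n
    simp [tmk_balanced, h])

/-- `Δ ⊗ id`, followed by the associativity isomorphism, for a right `B`-linear `Δ`. -/
def tensorId (Δ : M →ₗ[k] X.Tensor X)
    (h : ∀ b m, Δ (X.r (op b) m) = (X.tensorStr X).r (op b) (Δ m)) :
    X.Tensor X →ₗ[k] X.Tensor (X.tensorStr X) :=
  X.lift X (X.assocRight.flip ∘ₗ Δ) (by
    intro m b n
    simp [h, assocRight_r])

@[simp] theorem idTensor_tmk (Δ : M →ₗ[k] X.Tensor X)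
    (h : ∀ b m, Δ (X.l b m) = (X.tensorStr X).l b (Δ m)) (m n : M) :
    X.idTensor Δ h (X.tmk X m n) = X.tmk (X.tensorStr X) m (Δ n) :=
  X.lift_tmk X _ _ m n

@[simp] theorem tensorId_tmk (Δ : M →ₗ[k] X.Tensor X)
    (h : ∀ b m, Δ (X.r (op b) m) = (X.tensorStr X).r (op b) (Δ m)) (m n : M) :
    X.tensorId Δ h (X.tmk X m n) = X.assocRight n (Δ m) :=
  X.lift_tmk X _ _ m n

/-- `ε ⊗ id : M ⊗_B M → M`, `m ⊗ n ↦ ε m · n`, for a right `B`-linear `ε : M → B`. -/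
def counitId (ε : M →ₗ[k] B) (h : ∀ b m, ε (X.r (op b) m) = ε m * b) : X.Tensor X →ₗ[k] M :=
  X.lift X (LinearMap.mk₂ k (fun m n => X.l (ε m) n) (by simp) (by simp) (by simp) (by simp))
    (by intro m b n; simp [h])

@[simp] theorem counitId_tmk (ε : M →ₗ[k] B) (h : ∀ b m, ε (X.r (op b) m) = ε m * b)
    (m n : M) : X.counitId ε h (X.tmk X m n) = X.l (ε m) n :=
  X.lift_tmk X _ _ m n

/-- `id ⊗ ε : M ⊗_B M → M`, `m ⊗ n ↦ m · ε n`, for a left `B`-linear `ε : M → B`. -/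
def idCounit (ε : M →ₗ[k] B) (h : ∀ b m, ε (X.l b m) = b * ε m) : X.Tensor X →ₗ[k] M :=
  X.lift X (LinearMap.mk₂ k (fun m n => X.r (op (ε n)) m) (by simp) (by simp) (by simp)
    (by simp)) (by intro m b n; simp [h])

@[simp] theorem idCounit_tmk (ε : M →ₗ[k] B) (h : ∀ b m, ε (X.l b m) = b * ε m)
    (m n : M) : X.idCounit ε h (X.tmk X m n) = X.r (op (ε n)) m :=
  X.lift_tmk X _ _ m n

end BimoduleStr

/-- A `B`-coring structure on the bimodule `X`, i.e. the structure of a comonoid in the category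
of `B`-`B`-bimodules. -/
structure Coring (X : BimoduleStr k B M) where
  comul : M →ₗ[k] X.Tensor X
  counit : M →ₗ[k] B
  comul_l : ∀ b m, comul (X.l b m) = (X.tensorStr X).l b (comul m)
  comul_r : ∀ b m, comul (X.r (op b) m) = (X.tensorStr X).r (op b) (comul m)
  counit_l : ∀ b m, counit (X.l b m) = b * counit m
  counit_r : ∀ b m, counit (X.r (op b) m) = counit m * b
  coassoc : ∀ m, X.tensorId comul comul_r (comul m) = X.idTensor comul comul_l (comul m)
  counit_comul : ∀ m, X.counitId counit counit_r (comul m) = m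
  comul_counit : ∀ m, X.idCounit counit counit_l (comul m) = m

end Bimodules
/-! ### Frobenius homomorphisms -/

section Frobenius

variable {k B S M : Type*} [CommRing k] [Ring B] [Algebra k B]

/-- `x, y` is a dual basis of `F : S → B` for the extension `ι : B → S`. -/
def IsDualBasis [AddCommMonoid S] [Mul S] (ι : B → S) (F : S → B) {n : ℕ} (x y : Fin n → S) :
    Prop :=
  (∀ a, ∑ j, ι (F (a * x j)) * y j = a) ∧ ∀ a, ∑ j, x j * ι (F (y j * a)) = a

/-- `F : S → B` is a Frobenius homomorphism for the extension of algebras `ι : B → S`: a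
`B`-`B`-bimodule map possessing a (finite) dual basis. -/
structure IsFrobeniusHom [AddCommMonoid S] [Module k S] [Mul S] (ι : B → S) (F : S →ₗ[k] B) :
    Prop where
  map_left : ∀ b a, F (ι b * a) = b * F a
  map_right : ∀ a b, F (a * ι b) = F a * b
  exists_dualBasis : ∃ (n : ℕ) (x y : Fin n → S), IsDualBasis ι F x y

variable [Ring S] [Algebra k S] [AddCommGroup M] [Module k M]

/-- If `M` and `S` are identified by `θ` as modules, and the bimodule structure of `M` becomes
the natural one of the extension `ι : B → S`, then two dual bases can be compared in
`M ⊗_B M`. -/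
theorem IsDualBasis.sum_tmk (X : BimoduleStr k B M) (θ : M ≃ₗ[k] S) {ι : B → S} {F : S →ₗ[k] B}
    (hl : ∀ b m, θ (X.l b m) = ι b * θ m) (hr : ∀ b m, θ (X.r (op b) m) = θ m * ι b)
    {n n' : ℕ} {x y : Fin n → S} {x' y' : Fin n' → S}
    (h : IsDualBasis ι F x y) (h' : IsDualBasis ι F x' y') (p q : S → S)
    (hpq : ∀ a b, F (a * p b) = F (q a * b)) :
    ∑ j, X.tmk X (θ.symm (p (x j))) (θ.symm (y j)) =
      ∑ j, X.tmk X (θ.symm (x' j)) (θ.symm (q (y' j))) := by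
  have hl' : ∀ b a, θ.symm (ι b * a) = X.l b (θ.symm a) := fun b a => by
    rw [LinearEquiv.symm_apply_eq, hl, LinearEquiv.apply_symm_apply]
  have hr' : ∀ b a, θ.symm (a * ι b) = X.r (op b) (θ.symm a) := fun b a => by
    rw [LinearEquiv.symm_apply_eq, hr, LinearEquiv.apply_symm_apply]
  calc ∑ j, X.tmk X (θ.symm (p (x j))) (θ.symm (y j))
      = ∑ j, ∑ l, X.tmk X (θ.symm (x' l)) (θ.symm (ι (F (q (y' l) * x j)) * y j)) := by
        refine Finset.sum_congr rfl fun j _ => ?_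
        conv_lhs => rw [← h'.2 (p (x j))]
        rw [map_sum, map_sum, LinearMap.sum_apply]
        refine Finset.sum_congr rfl fun l _ => ?_
        rw [hr', X.tmk_balanced, hl', hpq]
    _ = ∑ l, X.tmk X (θ.symm (x' l)) (θ.symm (q (y' l))) := by
        rw [Finset.sum_comm]
        refine Finset.sum_congr rfl fun l _ => ?_
        conv_rhs => rw [← h.1 (q (y' l))]
        rw [map_sum, map_sum]

namespace IsFrobeniusHom

variable (X : BimoduleStr k B M) (θ : M ≃ₗ[k] S) {ι : B → S} {F : S →ₗ[k] B}
  (hF : IsFrobeniusHom ι F)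

/-- The comultiplication `m ↦ ∑ m x_j ⊗ y_j ∈ M ⊗_B M` determined by the dual basis of a
Frobenius homomorphism; it does not depend on the choice of the dual basis
(see `comul_apply`). -/
def comul : M →ₗ[k] X.Tensor X :=
  ∑ j, (X.tmk X).flip (θ.symm (hF.exists_dualBasis.choose_spec.choose_spec.choose j)) ∘ₗ
    θ.symm.toLinearMap ∘ₗ
      LinearMap.mulRight k (hF.exists_dualBasis.choose_spec.choose j) ∘ₗ θ.toLinearMap

theorem comul_apply'
    (hl : ∀ b m, θ (X.l b m) = ι b * θ m) (hr : ∀ b m, θ (X.r (op b) m) = θ m * ι b)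
    {n : ℕ} {x y : Fin n → S} (h : IsDualBasis ι F x y) (m : M) :
    hF.comul X θ m = ∑ j, X.tmk X (θ.symm (x j)) (θ.symm (y j * θ m)) := by
  have h0 := hF.exists_dualBasis.choose_spec.choose_spec.choose_spec
  rw [← IsDualBasis.sum_tmk X θ hl hr h0 h (fun s => θ m * s) (fun s => s * θ m)
    (fun a b => by rw [mul_assoc])]
  simp [comul]

theorem comul_apply
    (hl : ∀ b m, θ (X.l b m) = ι b * θ m) (hr : ∀ b m, θ (X.r (op b) m) = θ m * ι b)
    {n : ℕ} {x y : Fin n → S} (h : IsDualBasis ι F x y) (m : M) :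
    hF.comul X θ m = ∑ j, X.tmk X (θ.symm (θ m * x j)) (θ.symm (y j)) := by
  rw [hF.comul_apply' X θ hl hr h m,
    ← IsDualBasis.sum_tmk X θ hl hr h h (fun s => θ m * s) (fun s => s * θ m)
    (fun a b => by rw [mul_assoc])]

/-- The coring of a Frobenius homomorphism. -/
def coring
    (hl : ∀ b m, θ (X.l b m) = ι b * θ m) (hr : ∀ b m, θ (X.r (op b) m) = θ m * ι b) :
    Coring X :=
  have hl' : ∀ b a, θ.symm (ι b * a) = X.l b (θ.symm a) := fun b a => by
    rw [LinearEquiv.symm_apply_eq, hl, LinearEquiv.apply_symm_apply]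
  have hr' : ∀ b a, θ.symm (a * ι b) = X.r (op b) (θ.symm a) := fun b a => by
    rw [LinearEquiv.symm_apply_eq, hr, LinearEquiv.apply_symm_apply]
  { comul := hF.comul X θ
    counit := F ∘ₗ θ.toLinearMap
    comul_l := fun b m => by
      obtain ⟨n, x, y, h⟩ := hF.exists_dualBasis
      simp [hF.comul_apply X θ hl hr h, hl, mul_assoc, hl']
    comul_r := fun b m => by
      obtain ⟨n, x, y, h⟩ := hF.exists_dualBasis
      simp [hF.comul_apply' X θ hl hr h, hr, ← mul_assoc, hr']
    counit_l := fun b m => by simp [hl, hF.map_left]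
    counit_r := fun b m => by simp [hr, hF.map_right]
    coassoc := fun m => by
      obtain ⟨n, x, y, h⟩ := hF.exists_dualBasis
      conv_lhs => rw [hF.comul_apply X θ hl hr h m]
      conv_rhs => rw [hF.comul_apply' X θ hl hr h m]
      simp only [map_sum, BimoduleStr.tensorId_tmk, BimoduleStr.idTensor_tmk]
      simp only [fun a => hF.comul_apply' X θ hl hr h (θ.symm (θ m * a)),
        fun a => hF.comul_apply X θ hl hr h (θ.symm (a * θ m)), map_sum,
        BimoduleStr.assocRight_tmk, LinearEquiv.apply_symm_apply, mul_assoc]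
      exact Finset.sum_comm
    counit_comul := fun m => by
      obtain ⟨n, x, y, h⟩ := hF.exists_dualBasis
      rw [hF.comul_apply X θ hl hr h m]
      simp only [map_sum, BimoduleStr.counitId_tmk, LinearMap.comp_apply, LinearEquiv.coe_coe,
        LinearEquiv.apply_symm_apply, ← hl']
      rw [← map_sum, h.1, LinearEquiv.symm_apply_apply]
    comul_counit := fun m => by
      obtain ⟨n, x, y, h⟩ := hF.exists_dualBasis
      rw [hF.comul_apply' X θ hl hr h m]
      simp only [map_sum, BimoduleStr.idCounit_tmk, LinearMap.comp_apply, LinearEquiv.coe_coe,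
        LinearEquiv.apply_symm_apply, ← hr']
      rw [← map_sum, h.2, LinearEquiv.symm_apply_apply] }

theorem map_comul (hl : ∀ b m, θ (X.l b m) = ι b * θ m)
    (hr : ∀ b m, θ (X.r (op b) m) = θ m * ι b) (f g : Module.End k M)
    (hf : ∀ b m, f (X.r (op b) m) = X.r (op b) (f m)) (hg : ∀ b m, g (X.l b m) = X.l b (g m))
    (c c' : S) (hc : ∀ a, F (a * c) = F (c' * a)) (hfc : ∀ m, f m = θ.symm (θ m * c))
    (hgc : ∀ m, g m = θ.symm (c' * θ m)) (m : M) :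
    X.map X f 1 hf (by simp) (hF.comul X θ m) = X.map X 1 g (by simp) hg (hF.comul X θ m) := by
  obtain ⟨n, x, y, h⟩ := hF.exists_dualBasis
  conv_lhs => rw [hF.comul_apply X θ hl hr h m]
  conv_rhs => rw [hF.comul_apply' X θ hl hr h m]
  simp only [map_sum, BimoduleStr.map_tmk, hfc, hgc, LinearEquiv.apply_symm_apply,
    Module.End.one_apply]
  refine IsDualBasis.sum_tmk X θ hl hr h h (fun s => θ m * s * c) (fun s => c' * (s * θ m)) ?_
  intro a b
  rw [← mul_assoc, hc]
  simp only [mul_assoc]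

theorem comul_grouplike (hl : ∀ b m, θ (X.l b m) = ι b * θ m)
    (hr : ∀ b m, θ (X.r (op b) m) = θ m * ι b) (u : M)
    (hu : ∀ a, θ u * a = θ u * ι (F (θ u * a))) :
    hF.comul X θ u = X.tmk X u u := by
  have hl' : ∀ b a, θ.symm (ι b * a) = X.l b (θ.symm a) := fun b a => by
    rw [LinearEquiv.symm_apply_eq, hl, LinearEquiv.apply_symm_apply]
  have hr' : ∀ b a, θ.symm (a * ι b) = X.r (op b) (θ.symm a) := fun b a => by
    rw [LinearEquiv.symm_apply_eq, hr, LinearEquiv.apply_symm_apply]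
  obtain ⟨n, x, y, h⟩ := hF.exists_dualBasis
  rw [hF.comul_apply X θ hl hr h u]
  calc ∑ j, X.tmk X (θ.symm (θ u * x j)) (θ.symm (y j))
      = ∑ j, X.tmk X u (θ.symm (ι (F (θ u * x j)) * y j)) := by
        refine Finset.sum_congr rfl fun j _ => ?_
        conv_lhs => rw [hu (x j)]
        rw [hr', X.tmk_balanced, hl', LinearEquiv.symm_apply_apply]
    _ = X.tmk X u u := by
        rw [← map_sum, ← map_sum, h.1, LinearEquiv.symm_apply_apply]

end IsFrobeniusHom

end Frobenius

/-! ### Almost bialgebroids, their duals, and Frobenius integrals -/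

section AlmostBialgebroids

variable {k A B : Type*} [CommRing k] [Ring A] [Algebra k A] [Ring B] [Algebra k B]

/-- The bimodule `b · a · c = s(b) t(c) a` of a left bialgebroid. -/
def leftBimodule (s : B →ₐ[k] A) (t : Bᵐᵒᵖ →ₐ[k] A) (h : ∀ b c, s b * t c = t c * s b) :
    BimoduleStr k B A where
  l := (Algebra.lmul k A).comp s
  r := (Algebra.lmul k A).comp t
  comm b c a := by simp [← mul_assoc, h]

@[simp] theorem leftBimodule_l (s : B →ₐ[k] A) (t : Bᵐᵒᵖ →ₐ[k] A)
    (h : ∀ b c, s b * t c = t c * s b) (b : B) (a : A) : (leftBimodule s t h).l b a = s b * a :=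
  rfl

@[simp] theorem leftBimodule_r (s : B →ₐ[k] A) (t : Bᵐᵒᵖ →ₐ[k] A)
    (h : ∀ b c, s b * t c = t c * s b) (b : Bᵐᵒᵖ) (a : A) :
    (leftBimodule s t h).r b a = t b * a :=
  rfl

/-- The bimodule `b · a · c = a s(c) t(b)` of a right bialgebroid. -/
def rightBimodule (s : B →ₐ[k] A) (t : Bᵐᵒᵖ →ₐ[k] A) (h : ∀ b c, s b * t c = t c * s b) :
    BimoduleStr k B A where
  l := AlgHom.ofLinearMap
    { toFun := fun b => LinearMap.mulRight k (t (op b))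
      map_add' := fun b c => by ext; simp [mul_add]
      map_smul' := fun x b => by ext; simp }
    (by ext; simp) (fun b c => by ext; simp [mul_assoc])
  r := AlgHom.ofLinearMap
    { toFun := fun c => LinearMap.mulRight k (s c.unop)
      map_add' := fun b c => by ext; simp [mul_add]
      map_smul' := fun x b => by ext; simp }
    (by ext; simp) (fun b c => by ext; simp [mul_assoc])
  comm b c a := by simp [mul_assoc, h]

@[simp] theorem rightBimodule_l (s : B →ₐ[k] A) (t : Bᵐᵒᵖ →ₐ[k] A)
    (h : ∀ b c, s b * t c = t c * s b) (b : B) (a : A) :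
    (rightBimodule s t h).l b a = a * t (op b) :=
  rfl

@[simp] theorem rightBimodule_r (s : B →ₐ[k] A) (t : Bᵐᵒᵖ →ₐ[k] A)
    (h : ∀ b c, s b * t c = t c * s b) (b : Bᵐᵒᵖ) (a : A) :
    (rightBimodule s t h).r b a = a * s b.unop :=
  rfl

/-- A left almost bialgebroid `⟨A, B, s, t, Δ, ε⟩`: it satisfies all the axioms of a left
bialgebroid except, possibly, multiplicativity of the comultiplication. -/
structure LeftAlmostBialgebroid (k A B : Type*) [CommRing k] [Ring A] [Algebra k A] [Ring B]
    [Algebra k B] where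
  s : B →ₐ[k] A
  t : Bᵐᵒᵖ →ₐ[k] A
  comm : ∀ b c, s b * t c = t c * s b
  coring : Coring (leftBimodule s t comm)
  /-- `Δ(a)(t(b) ⊗ 1) = Δ(a)(1 ⊗ s(b))` -/
  takeuchi : ∀ a b,
    (leftBimodule s t comm).map (leftBimodule s t comm) (LinearMap.mulRight k (t (op b))) 1
      (by simp [mul_assoc]) (by simp) (coring.comul a) =
    (leftBimodule s t comm).map (leftBimodule s t comm) 1 (LinearMap.mulRight k (s b))
      (by simp) (by simp [mul_assoc]) (coring.comul a)
  comul_one : coring.comul 1 = (leftBimodule s t comm).tmk (leftBimodule s t comm) 1 1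
  counit_one : coring.counit 1 = 1
  counit_mul_s : ∀ a a', coring.counit (a * s (coring.counit a')) = coring.counit (a * a')
  counit_mul_t : ∀ a a', coring.counit (a * t (op (coring.counit a'))) = coring.counit (a * a')

/-- A right almost bialgebroid `⟨A, B, s, t, Δ, ε⟩`: it satisfies all the axioms of a right
bialgebroid except, possibly, multiplicativity of the comultiplication. -/
structure RightAlmostBialgebroid (k A B : Type*) [CommRing k] [Ring A] [Algebra k A] [Ring B]
    [Algebra k B] where
  s : B →ₐ[k] A
  t : Bᵐᵒᵖ →ₐ[k] A
  comm : ∀ b c, s b * t c = t c * s b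
  coring : Coring (rightBimodule s t comm)
  /-- `(s(b) ⊗ 1)Δ(a) = (1 ⊗ t(b))Δ(a)` -/
  takeuchi : ∀ a b,
    (rightBimodule s t comm).map (rightBimodule s t comm) (LinearMap.mulLeft k (s b)) 1
      (by simp [mul_assoc]) (by simp) (coring.comul a) =
    (rightBimodule s t comm).map (rightBimodule s t comm) 1 (LinearMap.mulLeft k (t (op b)))
      (by simp) (by simp [mul_assoc]) (coring.comul a)
  comul_one : coring.comul 1 = (rightBimodule s t comm).tmk (rightBimodule s t comm) 1 1
  counit_one : coring.counit 1 = 1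
  counit_s_mul : ∀ a a', coring.counit (s (coring.counit a) * a') = coring.counit (a * a')
  counit_t_mul : ∀ a a', coring.counit (t (op (coring.counit a)) * a') = coring.counit (a * a')

namespace LeftAlmostBialgebroid

variable (Q : LeftAlmostBialgebroid k A B)

/-- The bimodule underlying `Q`. -/
abbrev bimod : BimoduleStr k B A := leftBimodule Q.s Q.t Q.comm

/-- The right dual `{φ : A → B | φ(s(b) a) = b φ(a)}` of a left almost bialgebroid. -/
def rightDual : Submodule k (A →ₗ[k] B) where
  carrier := {φ | ∀ b a, φ (Q.s b * a) = b * φ a}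
  add_mem' hφ hψ b a := by simp [hφ b a, hψ b a, mul_add]
  zero_mem' b a := by simp
  smul_mem' c φ hφ b a := by simp [hφ b a]

/-- The map `A ⊗_B A → B`, `x ⊗ y ↦ ψ(t(φ(y)) x)`. -/
def convAux (φ ψ : Q.rightDual) : Q.bimod.Tensor Q.bimod →ₗ[k] B :=
  Q.bimod.lift Q.bimod
    (LinearMap.mk₂ k (fun x y => ψ.1 (Q.t (op (φ.1 y)) * x))
      (by simp [mul_add]) (by simp) (by simp [add_mul]) (by simp))
    (by
      intro x b y
      simp [φ.2 b y, mul_assoc])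

@[simp] theorem convAux_tmk (φ ψ : Q.rightDual) (x y : A) :
    Q.convAux φ ψ (Q.bimod.tmk Q.bimod x y) = ψ.1 (Q.t (op (φ.1 y)) * x) :=
  Q.bimod.lift_tmk Q.bimod _ _ x y

/-- The product `(φψ)(a) = ψ(t(φ(a₍₂₎)) a₍₁₎)` on the right dual. -/
instance : Mul Q.rightDual where
  mul φ ψ := ⟨Q.convAux φ ψ ∘ₗ Q.coring.comul, fun b a => by
    have h := Q.coring.comul_l b a
    rw [leftBimodule_l] at h
    have h2 : Q.convAux φ ψ ∘ₗ (Q.bimod.tensorStr Q.bimod).l b =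
        LinearMap.mulLeft k b ∘ₗ Q.convAux φ ψ := by
      refine Q.bimod.hom_ext Q.bimod fun x y => ?_
      simp only [convAux_tmk, LinearMap.comp_apply, BimoduleStr.tensorStr_l,
        LinearMap.mulLeft_apply, leftBimodule_l]
      rw [← mul_assoc, ← Q.comm, mul_assoc, ψ.2 b]
    rw [LinearMap.comp_apply, h]
    exact LinearMap.congr_fun h2 _⟩

/-- The source map `b ↦ ε(_) b` of the right dual. -/
def rightDualSource (b : B) : Q.rightDual :=
  ⟨LinearMap.mulRight k b ∘ₗ Q.coring.counit, fun c a => by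
    have h := Q.coring.counit_l c a
    rw [leftBimodule_l] at h
    simp [h, mul_assoc]⟩

/-- Evaluation of the elements of the right dual at `x : A`. -/
def evalAt (x : A) : Q.rightDual →ₗ[k] B := (LinearMap.applyₗ x) ∘ₗ Q.rightDual.subtype

/-- A left integral in `Q`. -/
def IsLeftIntegral (x : A) : Prop := ∀ a, a * x = Q.s (Q.coring.counit a) * x

/-- A Frobenius left integral in `Q`: a left integral which, as a functional on the right dual,
is a Frobenius homomorphism for the source map of the right dual. -/
def IsFrobeniusLeftIntegral (x : A) : Prop :=
  Q.IsLeftIntegral x ∧ IsFrobeniusHom (k := k) Q.rightDualSource (Q.evalAt x)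

/-- A right integral on `Q`: a right integral in the right dual. -/
def IsRightIntegralOn (ρ : Q.rightDual) : Prop :=
  ∀ ψ : Q.rightDual, ρ * ψ = ρ * Q.rightDualSource (ψ.1 1)

/-- A Frobenius right integral on `Q`: a right integral on `Q` which is a Frobenius homomorphism
for `s : B → A`. -/
def IsFrobeniusRightIntegralOn (ρ : Q.rightDual) : Prop :=
  Q.IsRightIntegralOn ρ ∧ IsFrobeniusHom (k := k) Q.s ρ.1

/-- `x : A` is the left integral dual to `ρ`: the map `a ↦ ρ(_ a)` sends `x` to `ε`. -/
def IsDualLeftIntegral (ρ : Q.rightDual) (x : A) : Prop :=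
  ∀ a, ρ.1 (a * x) = Q.coring.counit a

/-- `ρ` is the right integral dual to `x : A` regarded as a functional on the right dual: the
map `φ ↦ ⟨x, φ _⟩` sends `ρ` to the counit `ψ ↦ ψ(1)` of the right dual. -/
def IsDualRightIntegral (x : A) (ρ : Q.rightDual) : Prop :=
  ∀ ψ : Q.rightDual, (ρ * ψ).1 x = ψ.1 1

end LeftAlmostBialgebroid

namespace RightAlmostBialgebroid

variable (Q : RightAlmostBialgebroid k A B)

/-- The bimodule underlying `Q`. -/
abbrev bimod : BimoduleStr k B A := rightBimodule Q.s Q.t Q.comm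

/-- The left dual `{φ : A → B | φ(a s(b)) = φ(a) b}` of a right almost bialgebroid. -/
def leftDual : Submodule k (A →ₗ[k] B) where
  carrier := {φ | ∀ a b, φ (a * Q.s b) = φ a * b}
  add_mem' hφ hψ a b := by simp [hφ a b, hψ a b, add_mul]
  zero_mem' a b := by simp
  smul_mem' c φ hφ a b := by simp [hφ a b]

/-- The map `A ⊗_B A → B`, `x ⊗ y ↦ φ(y t(ψ(x)))`. -/
def convAux (φ ψ : Q.leftDual) : Q.bimod.Tensor Q.bimod →ₗ[k] B :=
  Q.bimod.lift Q.bimod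
    (LinearMap.mk₂ k (fun x y => φ.1 (y * Q.t (op (ψ.1 x))))
      (by simp [mul_add]) (by simp) (by simp [add_mul]) (by simp))
    (by
      intro x b y
      simp [ψ.2 x b, mul_assoc])

@[simp] theorem convAux_tmk (φ ψ : Q.leftDual) (x y : A) :
    Q.convAux φ ψ (Q.bimod.tmk Q.bimod x y) = φ.1 (y * Q.t (op (ψ.1 x))) :=
  Q.bimod.lift_tmk Q.bimod _ _ x y

/-- The product `(φψ)(a) = φ(a⁽²⁾ t(ψ(a⁽¹⁾)))` on the left dual. -/
instance : Mul Q.leftDual where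
  mul φ ψ := ⟨Q.convAux φ ψ ∘ₗ Q.coring.comul, fun a b => by
    have h := Q.coring.comul_r b a
    rw [rightBimodule_r] at h
    have h2 : Q.convAux φ ψ ∘ₗ (Q.bimod.tensorStr Q.bimod).r (op b) =
        LinearMap.mulRight k b ∘ₗ Q.convAux φ ψ := by
      refine Q.bimod.hom_ext Q.bimod fun x y => ?_
      simp only [convAux_tmk, LinearMap.comp_apply, BimoduleStr.tensorStr_r,
        LinearMap.mulRight_apply, rightBimodule_r, MulOpposite.unop_op]
      rw [mul_assoc, Q.comm, ← mul_assoc, φ.2 _ b]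
    rw [MulOpposite.unop_op] at h
    rw [LinearMap.comp_apply, h]
    exact LinearMap.congr_fun h2 _⟩

/-- The source map `b ↦ b ε(_)` of the left dual. -/
def leftDualSource (b : B) : Q.leftDual :=
  ⟨LinearMap.mulLeft k b ∘ₗ Q.coring.counit, fun a c => by
    have h := Q.coring.counit_r c a
    rw [rightBimodule_r, MulOpposite.unop_op] at h
    simp [h, mul_assoc]⟩

/-- Evaluation of the elements of the left dual at `x : A`. -/
def evalAt (x : A) : Q.leftDual →ₗ[k] B := (LinearMap.applyₗ x) ∘ₗ Q.leftDual.subtype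

/-- A right integral in `Q`. -/
def IsRightIntegral (x : A) : Prop := ∀ a, x * a = x * Q.s (Q.coring.counit a)

/-- A Frobenius right integral in `Q`: a right integral which, as a functional on the left dual,
is a Frobenius homomorphism for the source map of the left dual. -/
def IsFrobeniusRightIntegral (x : A) : Prop :=
  Q.IsRightIntegral x ∧ IsFrobeniusHom (k := k) Q.leftDualSource (Q.evalAt x)

/-- A left integral on `Q`: a left integral in the left dual. -/
def IsLeftIntegralOn (ρ : Q.leftDual) : Prop :=
  ∀ ψ : Q.leftDual, ψ * ρ = Q.leftDualSource (ψ.1 1) * ρ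

/-- A Frobenius left integral on `Q`: a left integral on `Q` which is a Frobenius homomorphism
for `s : B → A`. -/
def IsFrobeniusLeftIntegralOn (ρ : Q.leftDual) : Prop :=
  Q.IsLeftIntegralOn ρ ∧ IsFrobeniusHom (k := k) Q.s ρ.1

/-- `x : A` is the right integral dual to `ρ`: the map `a ↦ ρ(a _)` sends `x` to `ε`. -/
def IsDualRightIntegral (ρ : Q.leftDual) (x : A) : Prop :=
  ∀ a, ρ.1 (x * a) = Q.coring.counit a

/-- `ρ` is the left integral dual to `x : A` regarded as a functional on the left dual: the
map `φ ↦ ⟨x, _ φ⟩` sends `ρ` to the counit `ψ ↦ ψ(1)` of the left dual. -/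
def IsDualLeftIntegral (x : A) (ρ : Q.leftDual) : Prop :=
  ∀ ψ : Q.leftDual, (ψ * ρ).1 x = ψ.1 1

end RightAlmostBialgebroid

end AlmostBialgebroids

/-! ### Double algebras -/

section DoubleAlgebras

/-- A double algebra over `k`: a `k`-module `A` with two associative unital `k`-algebra
structures, the vertical one `(vmul, e)`, written `(∘, e)` in the comments, and the horizontal
one `(hmul, i)`, written `(⋆, i)`, such that the axioms `A1` - `A8` hold. -/
structure DoubleAlgebra (k A : Type*) [CommRing k] [AddCommGroup A] [Module k A] where
  vmul : A →ₗ[k] A →ₗ[k] A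
  e : A
  hmul : A →ₗ[k] A →ₗ[k] A
  i : A
  vmul_assoc : ∀ a b c, vmul (vmul a b) c = vmul a (vmul b c)
  e_vmul : ∀ a, vmul e a = a
  vmul_e : ∀ a, vmul a e = a
  hmul_assoc : ∀ a b c, hmul (hmul a b) c = hmul a (hmul b c)
  i_hmul : ∀ a, hmul i a = a
  hmul_i : ∀ a, hmul a i = a
  A1 : ∀ a b, vmul (hmul a e) b = hmul (vmul (hmul a e) i) b
  A2 : ∀ a b, vmul a (hmul b e) = hmul (vmul i (hmul b e)) a
  A3 : ∀ a b, hmul (vmul a i) b = vmul (hmul (vmul a i) e) b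
  A4 : ∀ a b, hmul a (vmul b i) = vmul (hmul e (vmul b i)) a
  A5 : ∀ a b, vmul a (hmul e b) = hmul a (vmul i (hmul e b))
  A6 : ∀ a b, vmul (hmul e a) b = hmul b (vmul (hmul e a) i)
  A7 : ∀ a b, hmul a (vmul i b) = vmul a (hmul e (vmul i b))
  A8 : ∀ a b, hmul (vmul i a) b = vmul b (hmul (vmul i a) e)

namespace DoubleAlgebra

variable {k A : Type*} [CommRing k] [AddCommGroup A] [Module k A] (D : DoubleAlgebra k A)

/-- The vertical algebra `V = ⟨A, ∘, e⟩`. -/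
def V (_D : DoubleAlgebra k A) : Type _ := A

/-- The horizontal algebra `H = ⟨A, ⋆, i⟩`. -/
def H (_D : DoubleAlgebra k A) : Type _ := A

instance : AddCommGroup D.V := inferInstanceAs (AddCommGroup A)
instance : Module k D.V := inferInstanceAs (Module k A)

/-- The identification of the `k`-module `A` with `V`. -/
def toV : A ≃ₗ[k] D.V := LinearEquiv.refl k A

instance : Ring D.V :=
  { (inferInstance : AddCommGroup D.V) with
    mul := fun a b => D.toV (D.vmul (D.toV.symm a) (D.toV.symm b))
    one := D.toV D.e
    mul_assoc := fun _ _ _ => D.vmul_assoc _ _ _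
    one_mul := fun _ => D.e_vmul _
    mul_one := fun _ => D.vmul_e _
    left_distrib := fun a _ _ => map_add (D.vmul (D.toV.symm a)) _ _
    right_distrib := fun _ _ _ => LinearMap.congr_fun (map_add D.vmul _ _) _
    zero_mul := fun _ => LinearMap.congr_fun (map_zero D.vmul) _
    mul_zero := fun a => map_zero (D.vmul (D.toV.symm a)) }

instance : Algebra k D.V :=
  Algebra.ofModule (fun r _ _ => LinearMap.congr_fun (map_smul D.vmul r _) _)
    (fun r a _ => map_smul (D.vmul (D.toV.symm a)) r _)

theorem toV_mul (a b : A) : D.toV a * D.toV b = D.toV (D.vmul a b) := rfl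

instance : AddCommGroup D.H := inferInstanceAs (AddCommGroup A)
instance : Module k D.H := inferInstanceAs (Module k A)

/-- The identification of the `k`-module `A` with `H`. -/
def toH : A ≃ₗ[k] D.H := LinearEquiv.refl k A

instance : Ring D.H :=
  { (inferInstance : AddCommGroup D.H) with
    mul := fun a b => D.toH (D.hmul (D.toH.symm a) (D.toH.symm b))
    one := D.toH D.i
    mul_assoc := fun _ _ _ => D.hmul_assoc _ _ _
    one_mul := fun _ => D.i_hmul _
    mul_one := fun _ => D.hmul_i _
    left_distrib := fun a _ _ => map_add (D.hmul (D.toH.symm a)) _ _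
    right_distrib := fun _ _ _ => LinearMap.congr_fun (map_add D.hmul _ _) _
    zero_mul := fun _ => LinearMap.congr_fun (map_zero D.hmul) _
    mul_zero := fun a => map_zero (D.hmul (D.toH.symm a)) }

instance : Algebra k D.H :=
  Algebra.ofModule (fun r _ _ => LinearMap.congr_fun (map_smul D.hmul r _) _)
    (fun r a _ => map_smul (D.hmul (D.toH.symm a)) r _)

theorem toH_mul (a b : A) : D.toH a * D.toH b = D.toH (D.hmul a b) := rfl

/-- `Φ_L(a) = a ⋆ e` -/
def phiL : A →ₗ[k] A := D.hmul.flip D.e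

/-- `Φ_R(a) = e ⋆ a` -/
def phiR : A →ₗ[k] A := D.hmul D.e

/-- `Φ_B(a) = a ∘ i` -/
def phiB : A →ₗ[k] A := D.vmul.flip D.i

/-- `Φ_T(a) = i ∘ a` -/
def phiT : A →ₗ[k] A := D.vmul D.i

theorem phiL_apply (a : A) : D.phiL a = D.hmul a D.e := rfl
theorem phiR_apply (a : A) : D.phiR a = D.hmul D.e a := rfl
theorem phiB_apply (a : A) : D.phiB a = D.vmul a D.i := rfl
theorem phiT_apply (a : A) : D.phiT a = D.vmul D.i a := rfl

theorem phiLBL (a : A) : D.phiL (D.phiB (D.phiL a)) = D.phiL a :=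
  (D.A1 a D.e).symm.trans (D.vmul_e _)
theorem phiLTL (a : A) : D.phiL (D.phiT (D.phiL a)) = D.phiL a :=
  (D.A2 D.e a).symm.trans (D.e_vmul _)
theorem phiBLB (a : A) : D.phiB (D.phiL (D.phiB a)) = D.phiB a :=
  (D.A3 a D.i).symm.trans (D.hmul_i _)
theorem phiBRB (a : A) : D.phiB (D.phiR (D.phiB a)) = D.phiB a :=
  (D.A4 D.i a).symm.trans (D.i_hmul _)
theorem phiRTR (a : A) : D.phiR (D.phiT (D.phiR a)) = D.phiR a :=
  (D.A5 D.e a).symm.trans (D.e_vmul _)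
theorem phiRBR (a : A) : D.phiR (D.phiB (D.phiR a)) = D.phiR a :=
  (D.A6 a D.e).symm.trans (D.vmul_e _)
theorem phiTRT (a : A) : D.phiT (D.phiR (D.phiT a)) = D.phiT a :=
  (D.A7 D.i a).symm.trans (D.i_hmul _)
theorem phiTLT (a : A) : D.phiT (D.phiL (D.phiT a)) = D.phiT a :=
  (D.A8 a D.i).symm.trans (D.hmul_i _)

/-- The left base algebra `L = Φ_L(A)`, a subalgebra of `V`. -/
def L : Subalgebra k D.V where
  carrier := {x | ∃ a, D.toV (D.phiL a) = x}
  mul_mem' := by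
    rintro _ _ ⟨a, rfl⟩ ⟨b, rfl⟩
    exact ⟨D.hmul (D.phiB (D.phiL a)) b, (D.hmul_assoc _ _ _).trans (D.A1 a _).symm⟩
  add_mem' := by
    rintro _ _ ⟨a, rfl⟩ ⟨b, rfl⟩
    exact ⟨a + b, by simp⟩
  algebraMap_mem' r := ⟨r • D.i, by
    rw [map_smul, map_smul, Algebra.algebraMap_eq_smul_one]
    exact congrArg (r • ·) (D.i_hmul _)⟩

/-- The base homomorphism `Φ_L : V → L`. -/
def PhiL : D.V →ₗ[k] D.L :=
  LinearMap.codRestrict (Subalgebra.toSubmodule D.L)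
    (D.toV.toLinearMap ∘ₗ D.phiL ∘ₗ D.toV.symm.toLinearMap) (fun a => ⟨D.toV.symm a, rfl⟩)

/-- The right base algebra `R = Φ_R(A)`, a subalgebra of `V`. -/
def R : Subalgebra k D.V where
  carrier := {x | ∃ a, D.toV (D.phiR a) = x}
  mul_mem' := by
    rintro _ _ ⟨a, rfl⟩ ⟨b, rfl⟩
    exact ⟨D.hmul a (D.phiT (D.phiR b)), (D.hmul_assoc _ _ _).symm.trans (D.A5 _ b).symm⟩
  add_mem' := by
    rintro _ _ ⟨a, rfl⟩ ⟨b, rfl⟩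
    exact ⟨a + b, by simp⟩
  algebraMap_mem' r := ⟨r • D.i, by
    rw [map_smul, map_smul, Algebra.algebraMap_eq_smul_one]
    exact congrArg (r • ·) (D.hmul_i _)⟩

/-- The base homomorphism `Φ_R : V → R`. -/
def PhiR : D.V →ₗ[k] D.R :=
  LinearMap.codRestrict (Subalgebra.toSubmodule D.R)
    (D.toV.toLinearMap ∘ₗ D.phiR ∘ₗ D.toV.symm.toLinearMap) (fun a => ⟨D.toV.symm a, rfl⟩)

/-- The bottom base algebra `B = Φ_B(A)`, a subalgebra of `H`. -/
def B : Subalgebra k D.H where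
  carrier := {x | ∃ a, D.toH (D.phiB a) = x}
  mul_mem' := by
    rintro _ _ ⟨a, rfl⟩ ⟨b, rfl⟩
    exact ⟨D.vmul (D.phiL (D.phiB a)) b, (D.vmul_assoc _ _ _).trans (D.A3 a _).symm⟩
  add_mem' := by
    rintro _ _ ⟨a, rfl⟩ ⟨b, rfl⟩
    exact ⟨a + b, by simp⟩
  algebraMap_mem' r := ⟨r • D.e, by
    rw [map_smul, map_smul, Algebra.algebraMap_eq_smul_one]
    exact congrArg (r • ·) (D.e_vmul _)⟩

/-- The base homomorphism `Φ_B : H → B`. -/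
def PhiB : D.H →ₗ[k] D.B :=
  LinearMap.codRestrict (Subalgebra.toSubmodule D.B)
    (D.toH.toLinearMap ∘ₗ D.phiB ∘ₗ D.toH.symm.toLinearMap) (fun a => ⟨D.toH.symm a, rfl⟩)

/-- The top base algebra `T = Φ_T(A)`, a subalgebra of `H`. -/
def T : Subalgebra k D.H where
  carrier := {x | ∃ a, D.toH (D.phiT a) = x}
  mul_mem' := by
    rintro _ _ ⟨a, rfl⟩ ⟨b, rfl⟩
    exact ⟨D.vmul a (D.phiR (D.phiT b)), (D.vmul_assoc _ _ _).symm.trans (D.A7 _ b).symm⟩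
  add_mem' := by
    rintro _ _ ⟨a, rfl⟩ ⟨b, rfl⟩
    exact ⟨a + b, by simp⟩
  algebraMap_mem' r := ⟨r • D.e, by
    rw [map_smul, map_smul, Algebra.algebraMap_eq_smul_one]
    exact congrArg (r • ·) (D.vmul_e _)⟩

/-- The base homomorphism `Φ_T : H → T`. -/
def PhiT : D.H →ₗ[k] D.T :=
  LinearMap.codRestrict (Subalgebra.toSubmodule D.T)
    (D.toH.toLinearMap ∘ₗ D.phiT ∘ₗ D.toH.symm.toLinearMap) (fun a => ⟨D.toH.symm a, rfl⟩)

/-- The algebra map `Φ_L|_B : B → V`. -/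
def phiLonB : D.B →ₐ[k] D.V :=
  AlgHom.ofLinearMap
    (D.toV.toLinearMap ∘ₗ D.phiL ∘ₗ D.toH.symm.toLinearMap ∘ₗ D.B.val.toLinearMap)
    (D.i_hmul _) (by
      rintro ⟨_, a, rfl⟩ ⟨_, b, rfl⟩
      exact (D.hmul_assoc _ _ _).trans (D.A3 a _))

/-- The algebra map `Φ_R|_B : Bᵒᵖ → V`. -/
def phiRonB : (D.B)ᵐᵒᵖ →ₐ[k] D.V :=
  AlgHom.ofLinearMap
    (D.toV.toLinearMap ∘ₗ D.phiR ∘ₗ D.toH.symm.toLinearMap ∘ₗ D.B.val.toLinearMap ∘ₗ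
      (MulOpposite.opLinearEquiv k).symm.toLinearMap)
    (D.hmul_i _) (by
      rintro ⟨_, a, rfl⟩ ⟨_, b, rfl⟩
      exact (D.hmul_assoc _ _ _).symm.trans (D.A4 _ a))

/-- The algebra map `Φ_R|_T : T → V`. -/
def phiRonT : D.T →ₐ[k] D.V :=
  AlgHom.ofLinearMap
    (D.toV.toLinearMap ∘ₗ D.phiR ∘ₗ D.toH.symm.toLinearMap ∘ₗ D.T.val.toLinearMap)
    (D.hmul_i _) (by
      rintro ⟨_, a, rfl⟩ ⟨_, b, rfl⟩
      exact (D.hmul_assoc _ _ _).symm.trans (D.A7 _ b))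

/-- The algebra map `Φ_L|_T : Tᵒᵖ → V`. -/
def phiLonT : (D.T)ᵐᵒᵖ →ₐ[k] D.V :=
  AlgHom.ofLinearMap
    (D.toV.toLinearMap ∘ₗ D.phiL ∘ₗ D.toH.symm.toLinearMap ∘ₗ D.T.val.toLinearMap ∘ₗ
      (MulOpposite.opLinearEquiv k).symm.toLinearMap)
    (D.i_hmul _) (by
      rintro ⟨_, a, rfl⟩ ⟨_, b, rfl⟩
      exact (D.hmul_assoc _ _ _).trans (D.A8 b _))

/-- The algebra map `Φ_B|_L : L → H`. -/
def phiBonL : D.L →ₐ[k] D.H :=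
  AlgHom.ofLinearMap
    (D.toH.toLinearMap ∘ₗ D.phiB ∘ₗ D.toV.symm.toLinearMap ∘ₗ D.L.val.toLinearMap)
    (D.e_vmul _) (by
      rintro ⟨_, a, rfl⟩ ⟨_, b, rfl⟩
      exact (D.vmul_assoc _ _ _).trans (D.A1 a _))

/-- The algebra map `Φ_T|_L : Lᵒᵖ → H`. -/
def phiTonL : (D.L)ᵐᵒᵖ →ₐ[k] D.H :=
  AlgHom.ofLinearMap
    (D.toH.toLinearMap ∘ₗ D.phiT ∘ₗ D.toV.symm.toLinearMap ∘ₗ D.L.val.toLinearMap ∘ₗ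
      (MulOpposite.opLinearEquiv k).symm.toLinearMap)
    (D.vmul_e _) (by
      rintro ⟨_, a, rfl⟩ ⟨_, b, rfl⟩
      exact (D.vmul_assoc _ _ _).symm.trans (D.A2 _ a))

/-- The algebra map `Φ_T|_R : R → H`. -/
def phiTonR : D.R →ₐ[k] D.H :=
  AlgHom.ofLinearMap
    (D.toH.toLinearMap ∘ₗ D.phiT ∘ₗ D.toV.symm.toLinearMap ∘ₗ D.R.val.toLinearMap)
    (D.vmul_e _) (by
      rintro ⟨_, a, rfl⟩ ⟨_, b, rfl⟩
      exact (D.vmul_assoc _ _ _).symm.trans (D.A5 _ b))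

/-- The algebra map `Φ_B|_R : Rᵒᵖ → H`. -/
def phiBonR : (D.R)ᵐᵒᵖ →ₐ[k] D.H :=
  AlgHom.ofLinearMap
    (D.toH.toLinearMap ∘ₗ D.phiB ∘ₗ D.toV.symm.toLinearMap ∘ₗ D.R.val.toLinearMap ∘ₗ
      (MulOpposite.opLinearEquiv k).symm.toLinearMap)
    (D.e_vmul _) (by
      rintro ⟨_, a, rfl⟩ ⟨_, b, rfl⟩
      exact (D.vmul_assoc _ _ _).trans (D.A6 b _))

/-- `L` and `R` commute within `V`. -/
theorem vmul_comm_LR (a b : A) :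
    D.vmul (D.phiL a) (D.phiR b) = D.vmul (D.phiR b) (D.phiL a) := by
  have h1 : D.vmul (D.phiL a) (D.phiR b) = D.hmul (D.phiL a) b := by
    have := D.phiLBL a
    rw [phiL_apply _ (D.phiB _)] at this
    rw [phiL_apply, D.A1, ← phiL_apply, ← phiB_apply, phiR_apply, ← D.hmul_assoc, this]
  have h2 : D.vmul (D.phiR b) (D.phiL a) = D.hmul (D.phiL a) b := by
    have := D.phiRBR b
    rw [phiR_apply _ (D.phiB _)] at this
    rw [phiR_apply, D.A6, ← phiR_apply, ← phiB_apply, phiL_apply, D.hmul_assoc, this, phiR_apply,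
      ← D.hmul_assoc]
  rw [h1, h2]

/-- `B` and `T` commute within `H`. -/
theorem hmul_comm_BT (a b : A) :
    D.hmul (D.phiB a) (D.phiT b) = D.hmul (D.phiT b) (D.phiB a) := by
  have h1 : D.hmul (D.phiB a) (D.phiT b) = D.vmul (D.phiB a) b := by
    have := D.phiBLB a
    rw [phiB_apply _ (D.phiL _)] at this
    rw [phiB_apply, D.A3, ← phiB_apply, ← phiL_apply, phiT_apply, ← D.vmul_assoc, this]
  have h2 : D.hmul (D.phiT b) (D.phiB a) = D.vmul (D.phiB a) b := by
    have := D.phiTLT b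
    rw [phiT_apply _ (D.phiL _)] at this
    rw [phiT_apply, D.A8, ← phiT_apply, ← phiL_apply, phiB_apply, D.vmul_assoc, this, phiT_apply,
      ← D.vmul_assoc]
  rw [h1, h2]

/-- A double algebra is Frobenius if its four base homomorphisms are Frobenius homomorphisms. -/
structure IsFrobenius : Prop where
  frobL : IsFrobeniusHom (k := k) (Subtype.val : D.L → D.V) D.PhiL
  frobR : IsFrobeniusHom (k := k) (Subtype.val : D.R → D.V) D.PhiR
  frobB : IsFrobeniusHom (k := k) (Subtype.val : D.B → D.H) D.PhiB
  frobT : IsFrobeniusHom (k := k) (Subtype.val : D.T → D.H) D.PhiT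

/-- An antipode of a double algebra. -/
structure IsAntipode (S : A →ₗ[k] A) : Prop where
  phiB_eq : ∀ a a' a'', D.phiB (D.hmul a' (D.vmul a'' a)) = D.phiB (D.hmul (D.vmul a' (S a)) a'')
  phiR_eq : ∀ a a' a'', D.phiR (D.vmul a' (D.hmul a a'')) = D.phiR (D.vmul (D.hmul (S a) a') a'')
  phiL_eq : ∀ a a' a'', D.phiL (D.vmul (D.hmul a' a) a'') = D.phiL (D.vmul a' (D.hmul a'' (S a)))
  phiT_eq : ∀ a a' a'', D.phiT (D.hmul (D.vmul a a') a'') = D.phiT (D.hmul a' (D.vmul (S a) a''))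

variable {D}

theorem takeuchi_auxB (D : DoubleAlgebra k A) (b x : A) :
    D.phiB (D.hmul x (D.phiT (D.phiR (D.phiB b)))) =
      D.phiB (D.hmul (D.phiT (D.phiL (D.phiB b))) x) := by
  have h1 : D.hmul x (D.phiT (D.phiR (D.phiB b))) = D.vmul x (D.phiR (D.phiB b)) :=
    (D.A5 x _).symm
  have h2 : D.hmul (D.phiT (D.phiL (D.phiB b))) x = D.vmul x (D.phiL (D.phiB b)) :=
    (D.A2 x _).symm
  have h3 := D.phiBRB b
  have h4 := D.phiBLB b
  rw [h1, h2]
  exact (D.vmul_assoc _ _ _).trans ((congrArg (D.vmul x) (h3.trans h4.symm)).trans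
    (D.vmul_assoc _ _ _).symm)

theorem takeuchi_auxT (D : DoubleAlgebra k A) (b x : A) :
    D.phiT (D.hmul x (D.phiB (D.phiR (D.phiT b)))) =
      D.phiT (D.hmul (D.phiB (D.phiL (D.phiT b))) x) := by
  have h1 : D.hmul x (D.phiB (D.phiR (D.phiT b))) = D.vmul (D.phiR (D.phiT b)) x :=
    (D.A6 _ x).symm
  have h2 : D.hmul (D.phiB (D.phiL (D.phiT b))) x = D.vmul (D.phiL (D.phiT b)) x :=
    (D.A1 _ x).symm
  have h3 := D.phiTRT b
  have h4 := D.phiTLT b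
  rw [h1, h2]
  exact (D.vmul_assoc _ _ _).symm.trans ((congrArg (fun z => D.vmul z x) (h3.trans h4.symm)).trans
    (D.vmul_assoc _ _ _))

theorem takeuchi_auxL (D : DoubleAlgebra k A) (b x : A) :
    D.phiL (D.vmul x (D.phiR (D.phiT (D.phiL b)))) =
      D.phiL (D.vmul (D.phiR (D.phiB (D.phiL b))) x) := by
  have h1 : D.vmul x (D.phiR (D.phiT (D.phiL b))) = D.hmul x (D.phiT (D.phiL b)) :=
    (D.A7 x _).symm
  have h2 : D.vmul (D.phiR (D.phiB (D.phiL b))) x = D.hmul x (D.phiB (D.phiL b)) :=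
    (D.A4 x _).symm
  have h3 := D.phiLTL b
  have h4 := D.phiLBL b
  rw [h1, h2]
  exact (D.hmul_assoc _ _ _).trans ((congrArg (D.hmul x) (h3.trans h4.symm)).trans
    (D.hmul_assoc _ _ _).symm)

theorem takeuchi_auxR (D : DoubleAlgebra k A) (b x : A) :
    D.phiR (D.vmul x (D.phiL (D.phiT (D.phiR b)))) =
      D.phiR (D.vmul (D.phiL (D.phiB (D.phiR b))) x) := by
  have h1 : D.vmul x (D.phiL (D.phiT (D.phiR b))) = D.hmul (D.phiT (D.phiR b)) x :=
    (D.A8 _ x).symm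
  have h2 : D.vmul (D.phiL (D.phiB (D.phiR b))) x = D.hmul (D.phiB (D.phiR b)) x :=
    (D.A3 _ x).symm
  have h3 := D.phiRTR b
  have h4 := D.phiRBR b
  rw [h1, h2]
  exact (D.hmul_assoc _ _ _).symm.trans ((congrArg (fun z => D.hmul z x) (h3.trans h4.symm)).trans
    (D.hmul_assoc _ _ _))

theorem comm_VB (D : DoubleAlgebra k A) (b : D.B) (c : (D.B)ᵐᵒᵖ) :
    D.phiLonB b * D.phiRonB c = D.phiRonB c * D.phiLonB b := D.vmul_comm_LR _ _

/-- The left almost bialgebroid `V_B = ⟨V, B, Φ_L|_B, Φ_R|_B, Δ_B, Φ_B⟩`. -/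
def VB (hD : D.IsFrobenius) : LeftAlmostBialgebroid k D.V D.B :=
  have hl : ∀ b m, (D.toV.symm.trans D.toH) ((leftBimodule D.phiLonB D.phiRonB (D.comm_VB)).l b m) = b.1 * (D.toV.symm.trans D.toH) m := by
    rintro ⟨_, a, rfl⟩ m
    exact (D.A3 a m).symm
  have hr : ∀ b m, (D.toV.symm.trans D.toH) ((leftBimodule D.phiLonB D.phiRonB (D.comm_VB)).r (op b) m) = (D.toV.symm.trans D.toH) m * b.1 := by
    rintro ⟨_, a, rfl⟩ m
    exact (D.A4 m a).symm
  { s := D.phiLonB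
    t := D.phiRonB
    comm := D.comm_VB
    coring := hD.frobB.coring (leftBimodule D.phiLonB D.phiRonB (D.comm_VB)) (D.toV.symm.trans D.toH) hl hr
    takeuchi := by
      rintro a ⟨_, b, rfl⟩
      exact hD.frobB.map_comul (leftBimodule D.phiLonB D.phiRonB (D.comm_VB)) (D.toV.symm.trans D.toH) hl hr _ _ _ _
        (D.toH (D.phiT (D.phiR (D.phiB b))))
        (D.toH (D.phiT (D.phiL (D.phiB b))))
        (fun x => Subtype.ext (D.takeuchi_auxB b x))
        (fun x => D.A5 x _) (fun x => D.A2 x _) a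
    comul_one := hD.frobB.comul_grouplike (leftBimodule D.phiLonB D.phiRonB (D.comm_VB)) (D.toV.symm.trans D.toH) hl hr _ (fun a => (D.phiRBR a).symm)
    counit_one := Subtype.ext (D.e_vmul _)
    counit_mul_s := fun a a' => Subtype.ext ((D.vmul_assoc _ _ _).trans ((congrArg (D.vmul a) (D.phiBLB a')).trans (D.vmul_assoc _ _ _).symm))
    counit_mul_t := fun a a' => Subtype.ext ((D.vmul_assoc _ _ _).trans ((congrArg (D.vmul a) (D.phiBRB a')).trans (D.vmul_assoc _ _ _).symm)) }

theorem comm_HL (D : DoubleAlgebra k A) (b : D.L) (c : (D.L)ᵐᵒᵖ) :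
    D.phiBonL b * D.phiTonL c = D.phiTonL c * D.phiBonL b := D.hmul_comm_BT _ _

/-- The left almost bialgebroid `H_L = ⟨H, L, Φ_B|_L, Φ_T|_L, Δ_L, Φ_L⟩`. -/
def HL (hD : D.IsFrobenius) : LeftAlmostBialgebroid k D.H D.L :=
  have hl : ∀ b m, (D.toH.symm.trans D.toV) ((leftBimodule D.phiBonL D.phiTonL (D.comm_HL)).l b m) = b.1 * (D.toH.symm.trans D.toV) m := by
    rintro ⟨_, a, rfl⟩ m
    exact (D.A1 a m).symm
  have hr : ∀ b m, (D.toH.symm.trans D.toV) ((leftBimodule D.phiBonL D.phiTonL (D.comm_HL)).r (op b) m) = (D.toH.symm.trans D.toV) m * b.1 := by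
    rintro ⟨_, a, rfl⟩ m
    exact (D.A2 m a).symm
  { s := D.phiBonL
    t := D.phiTonL
    comm := D.comm_HL
    coring := hD.frobL.coring (leftBimodule D.phiBonL D.phiTonL (D.comm_HL)) (D.toH.symm.trans D.toV) hl hr
    takeuchi := by
      rintro a ⟨_, b, rfl⟩
      exact hD.frobL.map_comul (leftBimodule D.phiBonL D.phiTonL (D.comm_HL)) (D.toH.symm.trans D.toV) hl hr _ _ _ _
        (D.toV (D.phiR (D.phiT (D.phiL b))))
        (D.toV (D.phiR (D.phiB (D.phiL b))))
        (fun x => Subtype.ext (D.takeuchi_auxL b x))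
        (fun x => D.A7 x _) (fun x => D.A4 x _) a
    comul_one := hD.frobL.comul_grouplike (leftBimodule D.phiBonL D.phiTonL (D.comm_HL)) (D.toH.symm.trans D.toV) hl hr _ (fun a => (D.phiTLT a).symm)
    counit_one := Subtype.ext (D.i_hmul _)
    counit_mul_s := fun a a' => Subtype.ext ((D.hmul_assoc _ _ _).trans ((congrArg (D.hmul a) (D.phiLBL a')).trans (D.hmul_assoc _ _ _).symm))
    counit_mul_t := fun a a' => Subtype.ext ((D.hmul_assoc _ _ _).trans ((congrArg (D.hmul a) (D.phiLTL a')).trans (D.hmul_assoc _ _ _).symm)) }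

theorem comm_VT (D : DoubleAlgebra k A) (b : D.T) (c : (D.T)ᵐᵒᵖ) :
    D.phiRonT b * D.phiLonT c = D.phiLonT c * D.phiRonT b := (D.vmul_comm_LR _ _).symm

/-- The right almost bialgebroid `V_T = ⟨V, T, Φ_R|_T, Φ_L|_T, Δ_T, Φ_T⟩`. -/
def VT (hD : D.IsFrobenius) : RightAlmostBialgebroid k D.V D.T :=
  have hl : ∀ b m, (D.toV.symm.trans D.toH) ((rightBimodule D.phiRonT D.phiLonT (D.comm_VT)).l b m) = b.1 * (D.toV.symm.trans D.toH) m := by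
    rintro ⟨_, a, rfl⟩ m
    exact (D.A8 a m).symm
  have hr : ∀ b m, (D.toV.symm.trans D.toH) ((rightBimodule D.phiRonT D.phiLonT (D.comm_VT)).r (op b) m) = (D.toV.symm.trans D.toH) m * b.1 := by
    rintro ⟨_, a, rfl⟩ m
    exact (D.A7 m a).symm
  { s := D.phiRonT
    t := D.phiLonT
    comm := D.comm_VT
    coring := hD.frobT.coring (rightBimodule D.phiRonT D.phiLonT (D.comm_VT)) (D.toV.symm.trans D.toH) hl hr
    takeuchi := by
      rintro a ⟨_, b, rfl⟩
      exact hD.frobT.map_comul (rightBimodule D.phiRonT D.phiLonT (D.comm_VT)) (D.toV.symm.trans D.toH) hl hr _ _ _ _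
        (D.toH (D.phiB (D.phiR (D.phiT b))))
        (D.toH (D.phiB (D.phiL (D.phiT b))))
        (fun x => Subtype.ext (D.takeuchi_auxT b x))
        (fun x => D.A6 _ x) (fun x => D.A1 _ x) a
    comul_one := hD.frobT.comul_grouplike (rightBimodule D.phiRonT D.phiLonT (D.comm_VT)) (D.toV.symm.trans D.toH) hl hr _ (fun a => (D.phiRTR a).symm)
    counit_one := Subtype.ext (D.vmul_e _)
    counit_s_mul := fun a a' => Subtype.ext ((D.vmul_assoc _ _ _).symm.trans ((congrArg (fun z => D.vmul z a') (D.phiTRT a)).trans (D.vmul_assoc _ _ _)))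
    counit_t_mul := fun a a' => Subtype.ext ((D.vmul_assoc _ _ _).symm.trans ((congrArg (fun z => D.vmul z a') (D.phiTLT a)).trans (D.vmul_assoc _ _ _))) }

theorem comm_HR (D : DoubleAlgebra k A) (b : D.R) (c : (D.R)ᵐᵒᵖ) :
    D.phiTonR b * D.phiBonR c = D.phiBonR c * D.phiTonR b := (D.hmul_comm_BT _ _).symm

/-- The right almost bialgebroid `H_R = ⟨H, R, Φ_T|_R, Φ_B|_R, Δ_R, Φ_R⟩`. -/
def HR (hD : D.IsFrobenius) : RightAlmostBialgebroid k D.H D.R :=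
  have hl : ∀ b m, (D.toH.symm.trans D.toV) ((rightBimodule D.phiTonR D.phiBonR (D.comm_HR)).l b m) = b.1 * (D.toH.symm.trans D.toV) m := by
    rintro ⟨_, a, rfl⟩ m
    exact (D.A6 a m).symm
  have hr : ∀ b m, (D.toH.symm.trans D.toV) ((rightBimodule D.phiTonR D.phiBonR (D.comm_HR)).r (op b) m) = (D.toH.symm.trans D.toV) m * b.1 := by
    rintro ⟨_, a, rfl⟩ m
    exact (D.A5 m a).symm
  { s := D.phiTonR
    t := D.phiBonR
    comm := D.comm_HR
    coring := hD.frobR.coring (rightBimodule D.phiTonR D.phiBonR (D.comm_HR)) (D.toH.symm.trans D.toV) hl hr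
    takeuchi := by
      rintro a ⟨_, b, rfl⟩
      exact hD.frobR.map_comul (rightBimodule D.phiTonR D.phiBonR (D.comm_HR)) (D.toH.symm.trans D.toV) hl hr _ _ _ _
        (D.toV (D.phiL (D.phiT (D.phiR b))))
        (D.toV (D.phiL (D.phiB (D.phiR b))))
        (fun x => Subtype.ext (D.takeuchi_auxR b x))
        (fun x => D.A8 _ x) (fun x => D.A3 _ x) a
    comul_one := hD.frobR.comul_grouplike (rightBimodule D.phiTonR D.phiBonR (D.comm_HR)) (D.toH.symm.trans D.toV) hl hr _ (fun a => (D.phiTRT a).symm)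
    counit_one := Subtype.ext (D.hmul_i _)
    counit_s_mul := fun a a' => Subtype.ext ((D.hmul_assoc _ _ _).symm.trans ((congrArg (fun z => D.hmul z a') (D.phiRTR a)).trans (D.hmul_assoc _ _ _)))
    counit_t_mul := fun a a' => Subtype.ext ((D.hmul_assoc _ _ _).symm.trans ((congrArg (fun z => D.hmul z a') (D.phiRBR a)).trans (D.hmul_assoc _ _ _))) }

theorem pairBL_aux (D : DoubleAlgebra k A) (b a h : A) :
    D.phiB (D.phiL (D.vmul (D.vmul (D.phiL (D.phiB b)) a) h)) =
      D.hmul (D.phiB b) (D.phiB (D.phiL (D.vmul a h))) := by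
  have h1 : ∀ x, D.vmul (D.phiL (D.phiB b)) x = D.hmul (D.phiB b) x := fun x => (D.A3 b x).symm
  rw [D.vmul_assoc, h1, D.phiL_apply (D.hmul _ _), D.hmul_assoc, ← h1, D.phiB_apply (D.vmul _ _),
    D.vmul_assoc, h1]
  rfl

theorem pairTR_aux (D : DoubleAlgebra k A) (t a h : A) :
    D.phiT (D.phiR (D.vmul h (D.vmul a (D.phiR (D.phiT t))))) =
      D.hmul (D.phiT (D.phiR (D.vmul h a))) (D.phiT t) := by
  have h1 : ∀ x, D.vmul x (D.phiR (D.phiT t)) = D.hmul x (D.phiT t) := fun x => (D.A7 x t).symm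
  rw [← D.vmul_assoc, h1, D.phiR_apply (D.hmul _ _), ← D.hmul_assoc, ← h1,
    D.phiT_apply (D.vmul _ _), ← D.vmul_assoc, h1]
  rfl

/-- The functional `v ↦ ⟨v, h⟩_BL = Φ_B Φ_L (v ∘ h)` in the right dual of `V_B`. -/
def pairBL (hD : D.IsFrobenius) (h : A) : (VB hD).rightDual :=
  ⟨D.PhiB ∘ₗ D.toH.toLinearMap ∘ₗ D.phiL ∘ₗ D.vmul.flip h ∘ₗ D.toV.symm.toLinearMap, by
    rintro ⟨_, b, rfl⟩ a
    exact Subtype.ext (D.pairBL_aux b (D.toV.symm a) h)⟩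

/-- The functional `v ↦ ⟨h, v⟩_TR = Φ_T Φ_R (h ∘ v)` in the left dual of `V_T`. -/
def pairTR (hD : D.IsFrobenius) (h : A) : (VT hD).leftDual :=
  ⟨D.PhiT ∘ₗ D.toH.toLinearMap ∘ₗ D.phiR ∘ₗ D.vmul h ∘ₗ D.toV.symm.toLinearMap, by
    rintro a ⟨_, t, rfl⟩
    exact Subtype.ext (D.pairTR_aux t (D.toV.symm a) h)⟩

variable (D)

/-- The inverse of `x` in the vertical algebra `V` (if `x` is invertible there). -/
def vinv (x : A) : A := D.toV.symm (Ring.inverse (D.toV x))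

/-- The inverse of `x` in the horizontal algebra `H` (if `x` is invertible there). -/
def hinv (x : A) : A := D.toH.symm (Ring.inverse (D.toH x))

/-- `T_⋆`: the horizontally invertible elements of `T`. -/
def Tstar : Set A := {x | D.toH x ∈ D.T ∧ IsUnit (D.toH x)}

/-- `B_⋆`: the horizontally invertible elements of `B`. -/
def Bstar : Set A := {x | D.toH x ∈ D.B ∧ IsUnit (D.toH x)}

/-- `R_∘`: the vertically invertible elements of `R`. -/
def Rcirc : Set A := {x | D.toV x ∈ D.R ∧ IsUnit (D.toV x)}

/-- `L_∘`: the vertically invertible elements of `L`. -/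
def Lcirc : Set A := {x | D.toV x ∈ D.L ∧ IsUnit (D.toV x)}

end DoubleAlgebra

end DoubleAlgebras

end

/-! Everything rests on one fact about a Frobenius homomorphism `F : S → B`: it is nondegenerate,
and `F (c * _)` (likewise `F (_ * c)`) is again Frobenius exactly when `c` is invertible and
commutes with the image of `B` (`comp_mulLeft_iff`, `comp_mulRight_iff`).

The dual of an almost bialgebroid is turned into such an `S`. For `V_B`, the map `w ↦ Φ_B (_ ⋆ w)`
is an algebra isomorphism from `H` onto the right dual, because `Δ_B` is given by the dual basis of
`Φ_B` (`dualEquiv_mul`). Under it, evaluation at `x` becomes `Φ_B (x ⋆ _)`. So the Frobenius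
condition on `x` says that `x` is invertible in `H` and commutes with `B`.

The integral equation itself is handled by `phiT_phiR_of_vmul_eq`. For `x` satisfying it, `x - Φ_T
Φ_R x` satisfies it too and is killed by `Φ_R`; the axioms then give `Φ_R (a ∘ y) = Φ_R (y) ⋆ Φ_B
(a)` for this difference `y`, so `y = 0` by nondegeneracy of `Φ_R`. Hence integrals in `V_B` are the
elements of `T`, which commute with `B` in `H` anyway. The other three bialgebroids follow from the
symmetries of the axioms.

For integrals on `V_B`, the equation in the dual becomes `w ⋆ a = w ⋆ Φ_B Φ_R a` in `H`. Its
solutions are the elements of `L`, and these are exactly the functionals `Φ_B Φ_L (_ ∘ r)` with `r ∈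
R`. Since `Φ_B Φ_L` is Frobenius on `V` and `R` commutes with `L`, such a functional is Frobenius
exactly when `r` is invertible. Duality then reduces to solving `x ∘ r = i` in `V` and `t ⋆ w = e`
in `H`. -/

noncomputable section

/-! ### Nondegeneracy and twisting of Frobenius homomorphisms; inverses in subalgebras. -/

section FrobeniusLemmas

variable {k B S : Type*} [CommRing k] [Ring B] [Algebra k B] [Ring S] [Algebra k S]
  {ι : B → S} {F : S →ₗ[k] B}

namespace IsFrobeniusHom

/-- The dual basis recovers `c` as `∑ ι (F (c * x j)) * y j`, so the functional `F (c * _)`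
determines `c`. -/
theorem ext_left (hF : IsFrobeniusHom ι F) {c d : S} (h : ∀ a, F (c * a) = F (d * a)) : c = d := by
  obtain ⟨n, x, y, hx⟩ := hF.exists_dualBasis
  rw [← hx.1 c, ← hx.1 d]
  simp only [h]

theorem ext_right (hF : IsFrobeniusHom ι F) {c d : S} (h : ∀ a, F (a * c) = F (a * d)) :
    c = d := by
  obtain ⟨n, x, y, hx⟩ := hF.exists_dualBasis
  rw [← hx.2 c, ← hx.2 d]
  simp only [h]

theorem eq_zero_of_left (hF : IsFrobeniusHom ι F) {c : S} (h : ∀ a, F (c * a) = 0) : c = 0 :=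
  hF.ext_left fun a => by rw [h, zero_mul, map_zero]

theorem eq_zero_of_right (hF : IsFrobeniusHom ι F) {c : S} (h : ∀ a, F (a * c) = 0) : c = 0 :=
  hF.ext_right fun a => by rw [h, mul_zero, map_zero]

/-- If `F (c * _)` is again a Frobenius homomorphism, then `c` is invertible and commutes with
the base algebra, and conversely. -/
theorem comp_mulLeft_iff (hF : IsFrobeniusHom ι F) (c : S) :
    IsFrobeniusHom ι (F ∘ₗ LinearMap.mulLeft k c) ↔ (∀ b, c * ι b = ι b * c) ∧ IsUnit c := by
  constructor
  · intro hG
    refine ⟨fun b => hF.ext_left fun a => ?_, ?_⟩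
    · have := hG.map_left b a
      simp only [LinearMap.comp_apply, LinearMap.mulLeft_apply] at this
      rw [mul_assoc, this, mul_assoc, hF.map_left]
    · obtain ⟨n, u, v, h1, h2⟩ := hG.exists_dualBasis
      simp only [LinearMap.comp_apply, LinearMap.mulLeft_apply] at h1 h2
      have hG1 := hG.map_left
      simp only [LinearMap.comp_apply, LinearMap.mulLeft_apply] at hG1
      -- With `G = F (c * _)` and its dual basis `u, v`, these elements express `F` through `G`: `F
      -- = G (_ * d)` and `F = G (d' * _)`. The second identity makes `d'` a right inverse of `c`.
      set d := ∑ j, u j * ι (F (v j)) with hd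
      set d' := ∑ j, ι (F (u j)) * v j with hd'
      have e1 : ∀ a, F (c * (a * d)) = F a := fun a => by
        conv_rhs => rw [← h1 a]
        simp [hd, Finset.mul_sum, hF.map_left, ← mul_assoc, hF.map_right]
      have e2 : ∀ a, F (c * (d' * a)) = F a := fun a => by
        conv_rhs => rw [← h2 a]
        simp [hd', Finset.sum_mul, Finset.mul_sum, hF.map_right, mul_assoc, hG1]
      have e3 : c * d' = 1 := hF.ext_left fun a => by rw [mul_assoc, e2, one_mul]
      -- Inserting `d` by `e1` puts a factor `c` to the left of `d'`, where `c * d' = 1` applies; a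
      -- second use of `e1` removes `d` again.
      have e4 : d' * c = 1 := hF.ext_left fun a => by
        rw [mul_assoc, ← e1, ← mul_assoc, ← mul_assoc, e3, one_mul, mul_assoc, e1, one_mul]
      exact ⟨⟨c, d', e3, e4⟩, rfl⟩
  · rintro ⟨hc, c, rfl⟩
    have hc' : ∀ b, (↑c⁻¹ : S) * ι b = ι b * ↑c⁻¹ := fun b => by
      rw [Units.inv_mul_eq_iff_eq_mul, ← mul_assoc, hc, mul_assoc, Units.mul_inv, mul_one]
    obtain ⟨n, x, y, h1, h2⟩ := hF.exists_dualBasis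
    -- The twist by `c` is absorbed into the second half of the dual basis of `F`.
    refine ⟨fun b a => ?_, fun a b => ?_, n, x, fun j => ↑c⁻¹ * y j, fun a => ?_, fun a => ?_⟩
    · simp [← mul_assoc, hc]
      rw [mul_assoc, hF.map_left]
    · simp [← mul_assoc, hF.map_right]
    · simp only [LinearMap.comp_apply, LinearMap.mulLeft_apply, ← mul_assoc, ← hc']
      simp only [mul_assoc, ← Finset.mul_sum]
      simp only [← mul_assoc c.1, h1]
      rw [← mul_assoc, Units.inv_mul, one_mul]
    · simp only [LinearMap.comp_apply, LinearMap.mulLeft_apply, mul_assoc,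
        Units.mul_inv_cancel_left, h2]

/-- If `F (_ * c)` is again a Frobenius homomorphism, then `c` is invertible and commutes with
the base algebra, and conversely. -/
theorem comp_mulRight_iff (hF : IsFrobeniusHom ι F) (c : S) :
    IsFrobeniusHom ι (F ∘ₗ LinearMap.mulRight k c) ↔ (∀ b, c * ι b = ι b * c) ∧ IsUnit c := by
  constructor
  · intro hG
    have hG2 := hG.map_right
    simp only [LinearMap.comp_apply, LinearMap.mulRight_apply] at hG2
    refine ⟨fun b => hF.ext_right fun a => ?_, ?_⟩
    · rw [← mul_assoc, hF.map_right, ← hG2, mul_assoc]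
    · obtain ⟨n, u, v, h1, h2⟩ := hG.exists_dualBasis
      simp only [LinearMap.comp_apply, LinearMap.mulRight_apply] at h1 h2
      -- Now `G = F (_ * c)`, and it is `d` that becomes a left inverse of `c`; `d'` serves to show
      -- that it is also a right inverse.
      set d := ∑ j, u j * ι (F (v j)) with hd
      set d' := ∑ j, ι (F (u j)) * v j with hd'
      have e1 : ∀ a, F (a * d * c) = F a := fun a => by
        conv_rhs => rw [← h1 a]
        simp [hd, Finset.mul_sum, Finset.sum_mul, hF.map_left, ← mul_assoc, hG2]
      have e2 : ∀ a, F (d' * a * c) = F a := fun a => by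
        conv_rhs => rw [← h2 a]
        simp [hd', Finset.sum_mul, hF.map_right, mul_assoc, hF.map_left]
      have e3 : d * c = 1 := hF.ext_right fun a => by rw [← mul_assoc, e1, mul_one]
      have e4 : c * d = 1 := hF.ext_right fun a => by
        rw [← e2, show d' * (a * (c * d)) * c = d' * (a * c) * (d * c) by simp only [mul_assoc], e3,
          mul_one, ← mul_assoc, e2, mul_one]
      exact ⟨⟨c, d, e4, e3⟩, rfl⟩
  · rintro ⟨hc, c, rfl⟩
    have hc' : ∀ b, (↑c⁻¹ : S) * ι b = ι b * ↑c⁻¹ := fun b => by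
      rw [Units.inv_mul_eq_iff_eq_mul, ← mul_assoc, hc, mul_assoc, Units.mul_inv, mul_one]
    obtain ⟨n, x, y, h1, h2⟩ := hF.exists_dualBasis
    refine ⟨fun b a => ?_, fun a b => ?_, n, fun j => x j * ↑c⁻¹, y, fun a => ?_, fun a => ?_⟩
    · simp [mul_assoc, hF.map_left]
    · simp only [LinearMap.comp_apply, LinearMap.mulRight_apply, mul_assoc, ← hc]
      rw [← mul_assoc, hF.map_right]
    · simp only [LinearMap.comp_apply, LinearMap.mulRight_apply, ← mul_assoc,
        Units.inv_mul_cancel_right, h1]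
    · simp only [LinearMap.comp_apply, LinearMap.mulRight_apply, mul_assoc, hc']
      simp only [← mul_assoc, ← Finset.sum_mul]
      simp only [mul_assoc (y _), h2, Units.mul_inv_cancel_right]

/-- Frobenius homomorphisms can be transported along multiplicative isomorphisms. -/
theorem congr_iff {S' : Type*} [AddCommMonoid S'] [Module k S'] [Mul S'] (f : S ≃ₗ[k] S')
    (hf : ∀ a b, f (a * b) = f a * f b) {ι' : B → S'} (hι : ∀ b, f (ι b) = ι' b)
    {F' : S' →ₗ[k] B} (hF' : ∀ a, F' (f a) = F a) :
    IsFrobeniusHom ι' F' ↔ IsFrobeniusHom ι F := by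
  constructor
  · rintro ⟨h1, h2, n, x, y, h3, h4⟩
    refine ⟨fun b a => ?_, fun a b => ?_, n, fun j => f.symm (x j), fun j => f.symm (y j),
      fun a => f.injective ?_, fun a => f.injective ?_⟩
    · rw [← hF', hf, hι, h1, hF']
    · rw [← hF', hf, hι, h2, hF']
    · simp only [map_sum, hf, hι, ← hF', LinearEquiv.apply_symm_apply, h3]
    · simp only [map_sum, hf, hι, ← hF', LinearEquiv.apply_symm_apply, h4]
  · rintro ⟨h1, h2, n, x, y, h3, h4⟩
    refine ⟨fun b a => ?_, fun a b => ?_, n, fun j => f (x j), fun j => f (y j),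
      fun a => ?_, fun a => ?_⟩
    · obtain ⟨a, rfl⟩ := f.surjective a
      rw [← hι, ← hf, hF', hF', h1]
    · obtain ⟨a, rfl⟩ := f.surjective a
      rw [← hι, ← hf, hF', hF', h2]
    · obtain ⟨a, rfl⟩ := f.surjective a
      simp only [← hf, hF', ← hι, ← map_sum, h3]
    · obtain ⟨a, rfl⟩ := f.surjective a
      simp only [← hf, hF', ← hι, ← map_sum, h4]

end IsFrobeniusHom

/-- By right linearity `F (u * x⁻¹) * x = F u = 1`, so `x⁻¹` is the value `F (u * x⁻¹)` and lies in
`T`. -/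
theorem Subalgebra.inverse_mem_of_map_mul {T : Subalgebra k S} (F : S →ₗ[k] T)
    (hF : ∀ a (b : T), F (a * b) = F a * b) {u : S} (hu : F u = 1) {x : S} (hx : x ∈ T) :
    Ring.inverse x ∈ T := by
  by_cases hunit : IsUnit x
  · have h := hF (u * Ring.inverse x) ⟨x, hx⟩
    rw [mul_assoc, Ring.inverse_mul_cancel x hunit, mul_one, hu] at h
    have h' : (F (u * Ring.inverse x) : S) * x = 1 := (congrArg Subtype.val h).symm
    have : (F (u * Ring.inverse x) : S) = Ring.inverse x := by
      rw [← mul_one (F _ : S), ← Ring.mul_inverse_cancel x hunit, ← mul_assoc, h', one_mul]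
    exact this ▸ (F (u * Ring.inverse x)).2
  -- `Ring.inverse` is `0` on non-units.
  · rw [Ring.inverse_non_unit x hunit]
    exact T.zero_mem

/-- The map `f` is defined on `T` only, so the inverse of `x` must be known to lie in `T` before it
can be transported. -/
theorem Subalgebra.isUnit_map_inverse {S' : Type*} [Ring S'] [Algebra k S'] {T : Subalgebra k S}
    {x : S} (hx : x ∈ T) (hunit : IsUnit x) (hx' : Ring.inverse x ∈ T) (f : T →ₐ[k] S') :
    IsUnit (f ⟨Ring.inverse x, hx'⟩) ∧ Ring.inverse (f ⟨Ring.inverse x, hx'⟩) = f ⟨x, hx⟩ := by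
  have h1 : f ⟨Ring.inverse x, hx'⟩ * f ⟨x, hx⟩ = 1 := by
    rw [← map_mul, ← map_one f]
    exact congrArg f (Subtype.ext (Ring.inverse_mul_cancel x hunit))
  have h2 : f ⟨x, hx⟩ * f ⟨Ring.inverse x, hx'⟩ = 1 := by
    rw [← map_mul, ← map_one f]
    exact congrArg f (Subtype.ext (Ring.mul_inverse_cancel x hunit))
  exact ⟨⟨⟨_, _, h1, h2⟩, rfl⟩, Ring.inverse_unit ⟨_, _, h1, h2⟩⟩

end FrobeniusLemmas

/-! ### The dual of an almost bialgebroid whose coring comes from a Frobenius homomorphism. -/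

section DualOfFrobenius

variable {k A B S : Type*} [CommRing k] [Ring A] [Algebra k A] [Ring B] [Algebra k B]
  [Ring S] [Algebra k S]

namespace LeftAlmostBialgebroid

/-- The coring underlying `Q` is the one determined by the Frobenius homomorphism `F`, up to the
identification `θ`. -/
structure IsOfFrobenius (Q : LeftAlmostBialgebroid k A B) (θ : A ≃ₗ[k] S) (ι : B → S)
    (F : S →ₗ[k] B) : Prop where
  frob : IsFrobeniusHom ι F
  s_mul : ∀ b m, θ (Q.s b * m) = ι b * θ m
  t_mul : ∀ b m, θ (Q.t (op b) * m) = θ m * ι b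
  counit : ∀ m, Q.coring.counit m = F (θ m)
  comul : ∀ {n : ℕ} {x y : Fin n → S}, IsDualBasis ι F x y → ∀ m,
    Q.coring.comul m = ∑ j, Q.bimod.tmk Q.bimod (θ.symm (θ m * x j)) (θ.symm (y j))

namespace IsOfFrobenius

variable {Q : LeftAlmostBialgebroid k A B} {θ : A ≃ₗ[k] S} {ι : B → S} {F : S →ₗ[k] B}
  (hQ : Q.IsOfFrobenius θ ι F)
include hQ

/-- The map `w ↦ F (θ _ * w)` from the algebra `S` to the right dual. -/
def dualHom : S →ₗ[k] Q.rightDual where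
  toFun w := ⟨F ∘ₗ LinearMap.mulRight k w ∘ₗ θ.toLinearMap, fun b a => by
    simp [hQ.s_mul, mul_assoc, hQ.frob.map_left]⟩
  map_add' v w := Subtype.ext (LinearMap.ext fun a => by simp [mul_add])
  map_smul' r w := Subtype.ext (LinearMap.ext fun a => by simp)

/-- The identification `w ↦ F (θ _ * w)` of the algebra `S` with the right dual. -/
def dualEquiv : S ≃ₗ[k] Q.rightDual :=
  LinearEquiv.ofBijective hQ.dualHom
    (by
      constructor
      · intro v w h
        refine hQ.frob.ext_right fun a => ?_
        have := LinearMap.congr_fun (congrArg Subtype.val h) (θ.symm a)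
        simpa [dualHom] using this
      · intro φ
        obtain ⟨n, x, y, h1, h2⟩ := hQ.frob.exists_dualBasis
        -- The witness comes from applying the left `B`-linear `φ` to the expansion of `a` as `∑ F
        -- (a x_j) · y_j`.
        refine ⟨∑ j, x j * ι (φ.1 (θ.symm (y j))), Subtype.ext (LinearMap.ext fun a => ?_)⟩
        have h3 : a = ∑ j, Q.s (F (θ a * x j)) * θ.symm (y j) := θ.injective (by
          simp [hQ.s_mul, h1])
        have hφ : ∀ b a, φ.1 (Q.s b * a) = b * φ.1 a := φ.2
        conv_rhs => rw [h3]
        simp [dualHom, hQ.frob.map_right, hφ])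

@[simp] theorem dualEquiv_apply (w : S) (a : A) : (hQ.dualEquiv w).1 a = F (θ a * w) := rfl

/-- Inserting `Δ(a) = ∑ a x_j ⊗ y_j` into the convolution product gives `F (a * (∑ x_j ι(F (y_j v)))
* w)`, and the inner sum is `v`. -/
theorem dualEquiv_mul (v w : S) : hQ.dualEquiv (v * w) = hQ.dualEquiv v * hQ.dualEquiv w := by
  obtain ⟨n, x, y, h⟩ := hQ.frob.exists_dualBasis
  refine Subtype.ext (LinearMap.ext fun a => ?_)
  change _ = Q.convAux _ _ (Q.coring.comul a)
  rw [hQ.comul h, map_sum]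
  simp only [convAux_tmk, dualEquiv_apply, hQ.t_mul, LinearEquiv.apply_symm_apply]
  rw [← map_sum, ← Finset.sum_mul]
  simp only [mul_assoc, ← Finset.mul_sum]
  simp only [h.2]

theorem dualEquiv_source (b : B) : hQ.dualEquiv (ι b) = Q.rightDualSource b := by
  refine Subtype.ext (LinearMap.ext fun a => ?_)
  rw [dualEquiv_apply, hQ.frob.map_right, ← hQ.counit]
  rfl

/-- Transported to `S`, evaluation at `x` is `F (θ x * _)`, so the twisting criterion decides when
it is Frobenius. -/
theorem isFrobeniusHom_evalAt_iff (x : A) :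
    IsFrobeniusHom (k := k) Q.rightDualSource (Q.evalAt x) ↔
      (∀ b, θ x * ι b = ι b * θ x) ∧ IsUnit (θ x) :=
  (IsFrobeniusHom.congr_iff hQ.dualEquiv hQ.dualEquiv_mul hQ.dualEquiv_source
    (F' := Q.evalAt x)
    (F := F ∘ₗ LinearMap.mulLeft k (θ x)) (fun _ => rfl)).trans (hQ.frob.comp_mulLeft_iff (θ x))

/-- The number `ψ(1)` for `ψ = F (θ _ * a)` is `F (θ 1 * a)`. The element `θ 1` need not be the unit
of `S`: for `V_B` it is `e`, read in `H`. -/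
theorem isRightIntegralOn_iff (w : S) :
    Q.IsRightIntegralOn (hQ.dualEquiv w) ↔ ∀ a, w * a = w * ι (F (θ 1 * a)) := by
  constructor
  · intro h a
    have := h (hQ.dualEquiv a)
    rw [← hQ.dualEquiv_source, ← dualEquiv_mul, ← dualEquiv_mul] at this
    exact hQ.dualEquiv.injective this
  · intro h ψ
    obtain ⟨a, rfl⟩ := hQ.dualEquiv.surjective ψ
    rw [← hQ.dualEquiv_source, ← dualEquiv_mul, ← dualEquiv_mul, h]
    rfl

theorem isDualRightIntegral_iff (x : A) (w : S) :
    Q.IsDualRightIntegral x (hQ.dualEquiv w) ↔ θ x * w = θ 1 := by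
  constructor
  · intro h
    refine hQ.frob.ext_left fun a => ?_
    have := h (hQ.dualEquiv a)
    rwa [← dualEquiv_mul, dualEquiv_apply, ← mul_assoc] at this
  · intro h ψ
    obtain ⟨a, rfl⟩ := hQ.dualEquiv.surjective ψ
    rw [← dualEquiv_mul, dualEquiv_apply, ← mul_assoc, h]
    rfl

end IsOfFrobenius

end LeftAlmostBialgebroid

namespace RightAlmostBialgebroid

/-- The coring underlying `Q` is the one determined by the Frobenius homomorphism `F`, up to the
identification `θ`. -/
structure IsOfFrobenius (Q : RightAlmostBialgebroid k A B) (θ : A ≃ₗ[k] S) (ι : B → S)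
    (F : S →ₗ[k] B) : Prop where
  frob : IsFrobeniusHom ι F
  mul_t : ∀ b m, θ (m * Q.t (op b)) = ι b * θ m
  mul_s : ∀ b m, θ (m * Q.s b) = θ m * ι b
  counit : ∀ m, Q.coring.counit m = F (θ m)
  comul : ∀ {n : ℕ} {x y : Fin n → S}, IsDualBasis ι F x y → ∀ m,
    Q.coring.comul m = ∑ j, Q.bimod.tmk Q.bimod (θ.symm (x j)) (θ.symm (y j * θ m))

namespace IsOfFrobenius

variable {Q : RightAlmostBialgebroid k A B} {θ : A ≃ₗ[k] S} {ι : B → S} {F : S →ₗ[k] B}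
  (hQ : Q.IsOfFrobenius θ ι F)
include hQ

/-- The map `w ↦ F (w * θ _)` from the algebra `S` to the left dual. -/
def dualHom : S →ₗ[k] Q.leftDual where
  toFun w := ⟨F ∘ₗ LinearMap.mulLeft k w ∘ₗ θ.toLinearMap, fun a b => by
    simp [hQ.mul_s, ← mul_assoc, hQ.frob.map_right]⟩
  map_add' v w := Subtype.ext (LinearMap.ext fun a => by simp [add_mul])
  map_smul' r w := Subtype.ext (LinearMap.ext fun a => by simp)

/-- The identification `w ↦ F (w * θ _)` of the algebra `S` with the left dual. -/
def dualEquiv : S ≃ₗ[k] Q.leftDual :=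
  LinearEquiv.ofBijective hQ.dualHom
    (by
      constructor
      · intro v w h
        refine hQ.frob.ext_left fun a => ?_
        have := LinearMap.congr_fun (congrArg Subtype.val h) (θ.symm a)
        simpa [dualHom] using this
      · intro φ
        obtain ⟨n, x, y, h1, h2⟩ := hQ.frob.exists_dualBasis
        refine ⟨∑ j, ι (φ.1 (θ.symm (x j))) * y j, Subtype.ext (LinearMap.ext fun a => ?_)⟩
        have h3 : a = ∑ j, θ.symm (x j) * Q.s (F (y j * θ a)) := θ.injective (by
          simp [hQ.mul_s, h2])
        have hφ : ∀ a b, φ.1 (a * Q.s b) = φ.1 a * b := φ.2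
        conv_rhs => rw [h3]
        simp [dualHom, hQ.frob.map_left, hφ])

@[simp] theorem dualEquiv_apply (w : S) (a : A) : (hQ.dualEquiv w).1 a = F (w * θ a) := rfl

/-- Here the form `Δ(a) = ∑ x_j ⊗ y_j a` is the convenient one: the product becomes `F (v * (∑ ι(F
(w x_j)) y_j) * a)`, and the inner sum is `w`. -/
theorem dualEquiv_mul (v w : S) : hQ.dualEquiv (v * w) = hQ.dualEquiv v * hQ.dualEquiv w := by
  obtain ⟨n, x, y, h⟩ := hQ.frob.exists_dualBasis
  refine Subtype.ext (LinearMap.ext fun a => ?_)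
  change _ = Q.convAux _ _ (Q.coring.comul a)
  rw [hQ.comul h, map_sum]
  simp only [convAux_tmk, dualEquiv_apply, hQ.mul_t, LinearEquiv.apply_symm_apply]
  rw [← map_sum, ← Finset.mul_sum]
  simp only [← mul_assoc, ← Finset.sum_mul, h.1]

theorem dualEquiv_source (b : B) : hQ.dualEquiv (ι b) = Q.leftDualSource b := by
  refine Subtype.ext (LinearMap.ext fun a => ?_)
  rw [dualEquiv_apply, hQ.frob.map_left, ← hQ.counit]
  rfl

theorem isFrobeniusHom_evalAt_iff (x : A) :
    IsFrobeniusHom (k := k) Q.leftDualSource (Q.evalAt x) ↔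
      (∀ b, θ x * ι b = ι b * θ x) ∧ IsUnit (θ x) :=
  (IsFrobeniusHom.congr_iff hQ.dualEquiv hQ.dualEquiv_mul hQ.dualEquiv_source
    (F' := Q.evalAt x)
    (F := F ∘ₗ LinearMap.mulRight k (θ x)) (fun _ => rfl)).trans (hQ.frob.comp_mulRight_iff (θ x))

theorem isLeftIntegralOn_iff (w : S) :
    Q.IsLeftIntegralOn (hQ.dualEquiv w) ↔ ∀ a, a * w = ι (F (a * θ 1)) * w := by
  constructor
  · intro h a
    have := h (hQ.dualEquiv a)
    rw [← hQ.dualEquiv_source, ← dualEquiv_mul, ← dualEquiv_mul] at this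
    exact hQ.dualEquiv.injective this
  · intro h ψ
    obtain ⟨a, rfl⟩ := hQ.dualEquiv.surjective ψ
    rw [← hQ.dualEquiv_source, ← dualEquiv_mul, ← dualEquiv_mul, h]
    rfl

theorem isDualLeftIntegral_iff (x : A) (w : S) :
    Q.IsDualLeftIntegral x (hQ.dualEquiv w) ↔ w * θ x = θ 1 := by
  constructor
  · intro h
    refine hQ.frob.ext_right fun a => ?_
    have := h (hQ.dualEquiv a)
    rwa [← dualEquiv_mul, dualEquiv_apply, mul_assoc] at this
  · intro h ψ
    obtain ⟨a, rfl⟩ := hQ.dualEquiv.surjective ψ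
    rw [← dualEquiv_mul, dualEquiv_apply, mul_assoc, h]
    rfl

end IsOfFrobenius

end RightAlmostBialgebroid

end DualOfFrobenius
end

noncomputable section

namespace DoubleAlgebra

variable {k A : Type*} [CommRing k] [AddCommGroup A] [Module k A]

/-! ### Symmetries of double algebras, and the integral equation. -/

section Symmetries

variable (D : DoubleAlgebra k A)

/-- The double algebra with the vertical and horizontal structures interchanged. -/
def swap : DoubleAlgebra k A where
  vmul := D.hmul
  e := D.i
  hmul := D.vmul
  i := D.e
  vmul_assoc := D.hmul_assoc
  e_vmul := D.i_hmul
  vmul_e := D.hmul_i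
  hmul_assoc := D.vmul_assoc
  i_hmul := D.e_vmul
  hmul_i := D.vmul_e
  A1 := D.A3
  A2 := D.A4
  A3 := D.A1
  A4 := D.A2
  A5 := D.A7
  A6 := D.A8
  A7 := D.A5
  A8 := D.A6

/-- The double algebra with the opposite vertical multiplication. -/
def vop : DoubleAlgebra k A where
  vmul := D.vmul.flip
  e := D.e
  hmul := D.hmul
  i := D.i
  vmul_assoc a b c := (D.vmul_assoc c b a).symm
  e_vmul := D.vmul_e
  vmul_e := D.e_vmul
  hmul_assoc := D.hmul_assoc
  i_hmul := D.i_hmul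
  hmul_i := D.hmul_i
  A1 a b := D.A2 b a
  A2 a b := D.A1 b a
  A3 a b := D.A8 a b
  A4 a b := D.A7 a b
  A5 a b := D.A6 b a
  A6 a b := D.A5 b a
  A7 a b := D.A4 a b
  A8 a b := D.A3 a b

theorem vmul_phiT_eq (a c : A) :
    D.vmul a (D.phiT c) = D.vmul (D.phiL (D.phiB a)) (D.phiT c) := by
  rw [phiT_apply, ← D.vmul_assoc, ← D.vmul_assoc]
  exact congrArg (fun z => D.vmul z c) (D.phiBLB a).symm

/-- The equation for `y` forces `y` to commute with `B` in `H`, whence `a ∘ y = y ⋆ Φ_B(a)` and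
`Φ_R(a ∘ y) = Φ_R(y) ⋆ Φ_B(a) = 0`. -/
theorem eq_zero_of_vmul_eq (hnd : ∀ y, (∀ a, D.phiR (D.vmul a y) = 0) → y = 0) {y : A}
    (hy : ∀ a, D.vmul a y = D.vmul (D.phiL (D.phiB a)) y) (hy0 : D.phiR y = 0) : y = 0 := by
  have hcomm : ∀ a, D.hmul y (D.phiB (D.phiR a)) = D.hmul (D.phiB (D.phiR a)) y := fun a =>
    (D.A6 a y).symm.trans ((hy _).trans (D.A3 _ y).symm)
  refine hnd y fun a => ?_
  have h1 : D.vmul a y = D.hmul y (D.phiB a) :=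
    -- Replacing `Φ_B(a)` by `Φ_B Φ_R Φ_B(a)` brings it to the shape for which `hcomm` gives
    -- commutation.
    (hy a).trans ((D.A3 a y).symm.trans (by rw [← phiB_apply, ← D.phiBRB a, hcomm]))
  rw [h1, phiR_apply, ← D.hmul_assoc, ← phiR_apply, hy0, map_zero, LinearMap.zero_apply]

/-- If `Φ_R` is nondegenerate, the left integrals of `V_B` lie in `T`. -/
theorem phiT_phiR_of_vmul_eq (hnd : ∀ y, (∀ a, D.phiR (D.vmul a y) = 0) → y = 0) {x : A}
    (hx : ∀ a, D.vmul a x = D.vmul (D.phiL (D.phiB a)) x) : D.phiT (D.phiR x) = x := by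
  -- Elements of `T` also solve the equation, so it passes to `x - Φ_T Φ_R x`, which `Φ_R`
  -- annihilates because `Φ_R Φ_T Φ_R = Φ_R`.
  refine (sub_eq_zero.mp (D.eq_zero_of_vmul_eq hnd (fun a => ?_) ?_)).symm
  · rw [map_sub, map_sub, hx, vmul_phiT_eq]
  · rw [map_sub, phiRTR, sub_self]

/-- `Φ_B Φ_L : V → B` -/
def PhiBL : D.V →ₗ[k] D.B := D.PhiB ∘ₗ D.toH.toLinearMap ∘ₗ D.phiL ∘ₗ D.toV.symm.toLinearMap

/-- `Φ_T Φ_R : V → T` -/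
def PhiTR : D.V →ₗ[k] D.T := D.PhiT ∘ₗ D.toH.toLinearMap ∘ₗ D.phiR ∘ₗ D.toV.symm.toLinearMap

end Symmetries

variable {D : DoubleAlgebra k A}

namespace IsFrobenius

variable (hD : D.IsFrobenius)
include hD

/-! ### Integrals are elements of the base algebras -/

theorem vmul_eq_iff_mem_T {x : A} :
    (∀ a, D.vmul a x = D.vmul (D.phiL (D.phiB a)) x) ↔ D.toH x ∈ D.T := by
  constructor
  · intro h
    exact ⟨_, D.phiT_phiR_of_vmul_eq (fun y hy =>
      hD.frobR.eq_zero_of_right (c := D.toV y) fun a => Subtype.ext (hy a)) h⟩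
  · rintro ⟨c, rfl⟩ a
    exact D.vmul_phiT_eq a c

/-- Interchanging the two products exchanges `L` with `B` and `R` with `T`; reversing the vertical
one exchanges `B` with `T`. These moves carry the criterion for `T` to the remaining cases. -/
theorem hmul_eq_iff_mem_R {x : A} :
    (∀ a, D.hmul a x = D.hmul (D.phiB (D.phiL a)) x) ↔ D.toV x ∈ D.R := by
  constructor
  · intro h
    exact ⟨_, D.swap.phiT_phiR_of_vmul_eq (fun y hy =>
      hD.frobT.eq_zero_of_right (c := D.toH y) fun a => Subtype.ext (hy a)) h⟩
  · rintro ⟨c, rfl⟩ a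
    exact D.swap.vmul_phiT_eq a c

theorem vmul_eq_iff_mem_B {x : A} :
    (∀ a, D.vmul x a = D.vmul x (D.phiR (D.phiT a))) ↔ D.toH x ∈ D.B := by
  constructor
  · intro h
    -- This composite reverses both products, taking `Φ_T Φ_R` to `Φ_B Φ_L`.
    exact ⟨_, D.swap.vop.swap.vop.phiT_phiR_of_vmul_eq (fun y hy =>
      hD.frobL.eq_zero_of_left (c := D.toV y) fun a => Subtype.ext (hy a)) h⟩
  · rintro ⟨c, rfl⟩ a
    exact D.swap.vop.swap.vop.vmul_phiT_eq a c

theorem hmul_eq_iff_mem_L {x : A} :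
    (∀ a, D.hmul x a = D.hmul x (D.phiT (D.phiR a))) ↔ D.toV x ∈ D.L := by
  constructor
  · intro h
    exact ⟨_, D.vop.swap.vop.phiT_phiR_of_vmul_eq (fun y hy =>
      hD.frobB.eq_zero_of_left (c := D.toH y) fun a => Subtype.ext (hy a)) h⟩
  · rintro ⟨c, rfl⟩ a
    exact D.vop.swap.vop.vmul_phiT_eq a c

/-- The fixed points of `Φ_L Φ_T` are the elements of `L`. This equation, with `Φ_B Φ_R` on the
right, is the one satisfied by right integrals on `V_B` after the dual is identified with `H`. -/
theorem hmul_eq_iff_phiL_phiT_eq {x : A} :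
    (∀ a, D.hmul x a = D.hmul x (D.phiB (D.phiR a))) ↔ D.phiL (D.phiT x) = x := by
  constructor
  · exact fun h => D.swap.vop.phiT_phiR_of_vmul_eq (fun y hy =>
      hD.frobT.eq_zero_of_left (c := D.toH y) fun a => Subtype.ext (hy a)) h
  · rintro h a
    rw [← h]
    exact D.swap.vop.vmul_phiT_eq a (D.phiT x)

theorem hmul_eq_iff_phiR_phiB_eq {x : A} :
    (∀ a, D.hmul a x = D.hmul (D.phiT (D.phiL a)) x) ↔ D.phiR (D.phiB x) = x := by
  constructor
  · exact fun h => D.vop.swap.phiT_phiR_of_vmul_eq (fun y hy =>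
      hD.frobB.eq_zero_of_right (c := D.toH y) fun a => Subtype.ext (hy a)) h
  · rintro h a
    rw [← h]
    exact D.vop.swap.vmul_phiT_eq a (D.phiB x)

/-! ### Frobenius integrals in the four almost bialgebroids -/

/-- The identification `θ` is the identity of `A`, from `V` to `H`; hence the dual of `V_B` is a
copy of `H`. -/
theorem isOfFrobenius_VB :
    (VB hD).IsOfFrobenius (D.toV.symm.trans D.toH) (Subtype.val : D.B → D.H) D.PhiB :=
  have hl : ∀ b m, (D.toV.symm.trans D.toH) ((VB hD).s b * m) = b.1 * (D.toV.symm.trans D.toH) m := by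
    rintro ⟨_, a, rfl⟩ m
    exact (D.A3 a m).symm
  have hr : ∀ b m,
      (D.toV.symm.trans D.toH) ((VB hD).t (op b) * m) = (D.toV.symm.trans D.toH) m * b.1 := by
    rintro ⟨_, a, rfl⟩ m
    exact (D.A4 m a).symm
  ⟨hD.frobB, hl, hr, fun _ => rfl,
    fun h m => hD.frobB.comul_apply (VB hD).bimod _ hl hr h m⟩

theorem isOfFrobenius_HL :
    (HL hD).IsOfFrobenius (D.toH.symm.trans D.toV) (Subtype.val : D.L → D.V) D.PhiL :=
  have hl : ∀ b m, (D.toH.symm.trans D.toV) ((HL hD).s b * m) = b.1 * (D.toH.symm.trans D.toV) m := by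
    rintro ⟨_, a, rfl⟩ m
    exact (D.A1 a m).symm
  have hr : ∀ b m,
      (D.toH.symm.trans D.toV) ((HL hD).t (op b) * m) = (D.toH.symm.trans D.toV) m * b.1 := by
    rintro ⟨_, a, rfl⟩ m
    exact (D.A2 m a).symm
  ⟨hD.frobL, hl, hr, fun _ => rfl,
    fun h m => hD.frobL.comul_apply (HL hD).bimod _ hl hr h m⟩

theorem isOfFrobenius_VT :
    (VT hD).IsOfFrobenius (D.toV.symm.trans D.toH) (Subtype.val : D.T → D.H) D.PhiT :=
  have hl : ∀ b m, (D.toV.symm.trans D.toH) (m * (VT hD).t (op b)) = b.1 * (D.toV.symm.trans D.toH) m := by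
    rintro ⟨_, a, rfl⟩ m
    exact (D.A8 a m).symm
  have hr : ∀ b m,
      (D.toV.symm.trans D.toH) (m * (VT hD).s b) = (D.toV.symm.trans D.toH) m * b.1 := by
    rintro ⟨_, a, rfl⟩ m
    exact (D.A7 m a).symm
  ⟨hD.frobT, hl, hr, fun _ => rfl,
    fun h m => hD.frobT.comul_apply' (VT hD).bimod _ hl hr h m⟩

theorem isOfFrobenius_HR :
    (HR hD).IsOfFrobenius (D.toH.symm.trans D.toV) (Subtype.val : D.R → D.V) D.PhiR :=
  have hl : ∀ b m, (D.toH.symm.trans D.toV) (m * (HR hD).t (op b)) = b.1 * (D.toH.symm.trans D.toV) m := by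
    rintro ⟨_, a, rfl⟩ m
    exact (D.A6 a m).symm
  have hr : ∀ b m,
      (D.toH.symm.trans D.toV) (m * (HR hD).s b) = (D.toH.symm.trans D.toV) m * b.1 := by
    rintro ⟨_, a, rfl⟩ m
    exact (D.A5 m a).symm
  ⟨hD.frobR, hl, hr, fun _ => rfl,
    fun h m => hD.frobR.comul_apply' (HR hD).bimod _ hl hr h m⟩

theorem isFrobeniusLeftIntegral_VB_iff (x : A) :
    (VB hD).IsFrobeniusLeftIntegral (D.toV x) ↔ x ∈ D.Tstar := by
  refine and_congr hD.vmul_eq_iff_mem_T Iff.rfl |>.trans (and_congr_right fun hx => ?_)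
  -- The commutation condition holds automatically, since `T` and `B` commute in `H`.
  refine (hD.isOfFrobenius_VB.isFrobeniusHom_evalAt_iff _).trans (and_iff_right ?_)
  obtain ⟨c, rfl⟩ := hx
  rintro ⟨_, b, rfl⟩
  exact (D.hmul_comm_BT b c).symm

theorem isFrobeniusLeftIntegral_HL_iff (x : A) :
    (HL hD).IsFrobeniusLeftIntegral (D.toH x) ↔ x ∈ D.Rcirc := by
  refine and_congr hD.hmul_eq_iff_mem_R Iff.rfl |>.trans (and_congr_right fun hx => ?_)
  refine (hD.isOfFrobenius_HL.isFrobeniusHom_evalAt_iff _).trans (and_iff_right ?_)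
  obtain ⟨c, rfl⟩ := hx
  rintro ⟨_, b, rfl⟩
  exact (D.vmul_comm_LR b c).symm

theorem isFrobeniusRightIntegral_VT_iff (x : A) :
    (VT hD).IsFrobeniusRightIntegral (D.toV x) ↔ x ∈ D.Bstar := by
  refine and_congr hD.vmul_eq_iff_mem_B Iff.rfl |>.trans (and_congr_right fun hx => ?_)
  refine (hD.isOfFrobenius_VT.isFrobeniusHom_evalAt_iff _).trans (and_iff_right ?_)
  obtain ⟨c, rfl⟩ := hx
  rintro ⟨_, b, rfl⟩
  exact D.hmul_comm_BT c b

theorem isFrobeniusRightIntegral_HR_iff (x : A) :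
    (HR hD).IsFrobeniusRightIntegral (D.toH x) ↔ x ∈ D.Lcirc := by
  refine and_congr hD.hmul_eq_iff_mem_L Iff.rfl |>.trans (and_congr_right fun hx => ?_)
  refine (hD.isOfFrobenius_HR.isFrobeniusHom_evalAt_iff _).trans (and_iff_right ?_)
  obtain ⟨c, rfl⟩ := hx
  rintro ⟨_, b, rfl⟩
  exact D.vmul_comm_LR c b

/-! ### Invertible elements of the base algebras -/

theorem hinv_mem_T {t : A} (ht : D.toH t ∈ D.T) : D.toH (D.hinv t) ∈ D.T :=
  -- The normalizing element is `e`, since `Φ_T(e) = i ∘ e = i` is the unit of `H`.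
  Subalgebra.inverse_mem_of_map_mul D.PhiT hD.frobT.map_right (u := D.toH D.e)
    (Subtype.ext (D.vmul_e _)) ht

theorem hinv_mem_B {b : A} (hb : D.toH b ∈ D.B) : D.toH (D.hinv b) ∈ D.B :=
  Subalgebra.inverse_mem_of_map_mul D.PhiB hD.frobB.map_right (u := D.toH D.e)
    (Subtype.ext (D.e_vmul _)) hb

theorem vinv_mem_R {r : A} (hr : D.toV r ∈ D.R) : D.toV (D.vinv r) ∈ D.R :=
  Subalgebra.inverse_mem_of_map_mul D.PhiR hD.frobR.map_right (u := D.toV D.i)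
    (Subtype.ext (D.hmul_i _)) hr

theorem vinv_mem_L {l : A} (hl : D.toV l ∈ D.L) : D.toV (D.vinv l) ∈ D.L :=
  Subalgebra.inverse_mem_of_map_mul D.PhiL hD.frobL.map_right (u := D.toV D.i)
    (Subtype.ext (D.i_hmul _)) hl

theorem phiR_hinv {t : A} (ht : t ∈ D.Tstar) :
    D.phiR (D.hinv t) ∈ D.Rcirc ∧ D.vinv (D.phiR (D.hinv t)) = D.phiR t := by
  have h := Subalgebra.isUnit_map_inverse ht.1 ht.2 (hD.hinv_mem_T ht.1) D.phiRonT
  exact ⟨⟨⟨_, rfl⟩, h.1⟩, h.2⟩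

theorem phiL_hinv {b : A} (hb : b ∈ D.Bstar) :
    D.phiL (D.hinv b) ∈ D.Lcirc ∧ D.vinv (D.phiL (D.hinv b)) = D.phiL b := by
  have h := Subalgebra.isUnit_map_inverse hb.1 hb.2 (hD.hinv_mem_B hb.1) D.phiLonB
  exact ⟨⟨⟨_, rfl⟩, h.1⟩, h.2⟩

theorem phiT_vinv {r : A} (hr : r ∈ D.Rcirc) :
    D.phiT (D.vinv r) ∈ D.Tstar ∧ D.hinv (D.phiT (D.vinv r)) = D.phiT r := by
  have h := Subalgebra.isUnit_map_inverse hr.1 hr.2 (hD.vinv_mem_R hr.1) D.phiTonR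
  exact ⟨⟨⟨_, rfl⟩, h.1⟩, h.2⟩

theorem phiB_vinv {l : A} (hl : l ∈ D.Lcirc) :
    D.phiB (D.vinv l) ∈ D.Bstar ∧ D.hinv (D.phiB (D.vinv l)) = D.phiB l := by
  have h := Subalgebra.isUnit_map_inverse hl.1 hl.2 (hD.vinv_mem_L hl.1) D.phiBonL
  exact ⟨⟨⟨_, rfl⟩, h.1⟩, h.2⟩

/-- For `r = Φ_R(t⁻¹)` the inverse is `r⁻¹ = Φ_R(t)`, and `Φ_T Φ_R` fixes `T`; symmetrically `Φ_R
Φ_T` fixes `R`. -/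
theorem invOn_Tstar_Rcirc :
    Set.InvOn (fun r => D.phiT (D.vinv r)) (fun t => D.phiR (D.hinv t)) D.Tstar D.Rcirc := by
  constructor
  · intro t ht
    obtain ⟨c, rfl⟩ := ht.1
    exact (congrArg D.phiT (hD.phiR_hinv ht).2).trans (D.phiTRT c)
  · intro r hr
    obtain ⟨c, rfl⟩ := hr.1
    exact (congrArg D.phiR (hD.phiT_vinv hr).2).trans (D.phiRTR c)

theorem invOn_Bstar_Lcirc :
    Set.InvOn (fun l => D.phiB (D.vinv l)) (fun b => D.phiL (D.hinv b)) D.Bstar D.Lcirc := by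
  constructor
  · intro b hb
    obtain ⟨c, rfl⟩ := hb.1
    exact (congrArg D.phiB (hD.phiL_hinv hb).2).trans (D.phiBLB c)
  · intro l hl
    obtain ⟨c, rfl⟩ := hl.1
    exact (congrArg D.phiL (hD.phiB_vinv hl).2).trans (D.phiLBL c)

/-! ### Frobenius integrals on `V_B` and `V_T` -/

/-- The maps `Φ_B` and `Φ_L` restrict to inverse isomorphisms between `L` and `B`, so this is `Φ_L :
V → L` with its base renamed. The dual basis of `Φ_L` is kept. -/
theorem frobBL : IsFrobeniusHom (k := k) D.phiLonB D.PhiBL := by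
  obtain ⟨n, x, y, h1, h2⟩ := hD.frobL.exists_dualBasis
  have hL : ∀ a, D.phiLonB (D.PhiBL a) = (D.PhiL a).1 := fun a => D.phiLBL _
  refine ⟨?_, ?_, n, x, y, ?_, ?_⟩
  · rintro ⟨_, c, rfl⟩ a
    have h := congrArg D.phiBonL (hD.frobL.map_left ⟨D.toV (D.phiL (D.phiB c)), _, rfl⟩ a)
    rw [map_mul D.phiBonL] at h
    exact Subtype.ext (h.trans (congrArg (fun z => D.hmul z _) (D.phiBLB c)))
  · rintro a ⟨_, c, rfl⟩
    have h := congrArg D.phiBonL (hD.frobL.map_right a ⟨D.toV (D.phiL (D.phiB c)), _, rfl⟩)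
    rw [map_mul D.phiBonL] at h
    exact Subtype.ext (h.trans (congrArg (D.hmul _) (D.phiBLB c)))
  · simpa only [hL] using h1
  · simpa only [hL] using h2

theorem frobTR : IsFrobeniusHom (k := k) D.phiRonT D.PhiTR := by
  obtain ⟨n, x, y, h1, h2⟩ := hD.frobR.exists_dualBasis
  have hR : ∀ a, D.phiRonT (D.PhiTR a) = (D.PhiR a).1 := fun a => D.phiRTR _
  refine ⟨?_, ?_, n, x, y, ?_, ?_⟩
  · rintro ⟨_, c, rfl⟩ a
    have h := congrArg D.phiTonR (hD.frobR.map_left ⟨D.toV (D.phiR (D.phiT c)), _, rfl⟩ a)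
    rw [map_mul D.phiTonR] at h
    exact Subtype.ext (h.trans (congrArg (fun z => D.hmul z _) (D.phiTRT c)))
  · rintro a ⟨_, c, rfl⟩
    have h := congrArg D.phiTonR (hD.frobR.map_right a ⟨D.toV (D.phiR (D.phiT c)), _, rfl⟩)
    rw [map_mul D.phiTonR] at h
    exact Subtype.ext (h.trans (congrArg (D.hmul _) (D.phiTRT c)))
  · simpa only [hR] using h1
  · simpa only [hR] using h2

theorem pairBL_eq_comp (r : A) : (pairBL hD r).1 = D.PhiBL ∘ₗ LinearMap.mulRight k (D.toV r) :=
  rfl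

theorem pairTR_eq_comp (l : A) : (pairTR hD l).1 = D.PhiTR ∘ₗ LinearMap.mulLeft k (D.toV l) :=
  rfl

theorem pairBL_injective : Function.Injective (pairBL hD) := fun r r' h =>
  D.toV.injective (hD.frobBL.ext_right fun a => by
    have h' := LinearMap.congr_fun (congrArg Subtype.val h) a
    rwa [pairBL_eq_comp, pairBL_eq_comp] at h')

theorem pairTR_injective : Function.Injective (pairTR hD) := fun l l' h =>
  D.toV.injective (hD.frobTR.ext_left fun a => by
    have h' := LinearMap.congr_fun (congrArg Subtype.val h) a
    rwa [pairTR_eq_comp, pairTR_eq_comp] at h')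

/-- For `r ∈ R`, axiom `A5` turns `a ∘ r` into `a ⋆ Φ_T(r)`, so `Φ_L(a ∘ r) = a ⋆ Φ_L Φ_T(r)`. -/
theorem dualEquiv_VB {r : A} (hr : D.toV r ∈ D.R) :
    hD.isOfFrobenius_VB.dualEquiv (D.toH (D.phiL (D.phiT r))) = pairBL hD r := by
  obtain ⟨c, rfl⟩ := hr
  refine Subtype.ext (LinearMap.ext fun a => Subtype.ext (congrArg D.phiB ?_))
  exact (D.hmul_assoc _ _ _).symm.trans (congrArg D.phiL (D.A5 _ c).symm)

theorem dualEquiv_VT {l : A} (hl : D.toV l ∈ D.L) :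
    hD.isOfFrobenius_VT.dualEquiv (D.toH (D.phiR (D.phiB l))) = pairTR hD l := by
  obtain ⟨c, rfl⟩ := hl
  refine Subtype.ext (LinearMap.ext fun a => Subtype.ext (congrArg D.phiT ?_))
  exact (D.hmul_assoc _ _ _).trans (congrArg D.phiR (D.A1 c _).symm)

theorem isRightIntegralOn_VB_iff (ρ : (VB hD).rightDual) :
    (VB hD).IsRightIntegralOn ρ ↔ ∃ r, D.toV r ∈ D.R ∧ pairBL hD r = ρ := by
  constructor
  · intro h
    obtain ⟨w, rfl⟩ := hD.isOfFrobenius_VB.dualEquiv.surjective ρ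
    have hw := hD.hmul_eq_iff_phiL_phiT_eq.mp ((hD.isOfFrobenius_VB.isRightIntegralOn_iff w).mp h)
    -- An integral has `w = Φ_L Φ_T w`, and `r = Φ_R Φ_T w` satisfies `Φ_T r = Φ_T w`; hence `Φ_L
    -- Φ_T r = w`.
    refine ⟨D.phiR (D.phiT (D.toH.symm w)), ⟨_, rfl⟩, ?_⟩
    rw [← hD.dualEquiv_VB ⟨_, rfl⟩, phiTRT]
    exact congrArg _ hw
  · rintro ⟨r, hr, rfl⟩
    rw [← hD.dualEquiv_VB hr, hD.isOfFrobenius_VB.isRightIntegralOn_iff]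
    exact hD.hmul_eq_iff_phiL_phiT_eq.mpr (congrArg D.phiL (D.phiTLT r))

theorem isLeftIntegralOn_VT_iff (ρ : (VT hD).leftDual) :
    (VT hD).IsLeftIntegralOn ρ ↔ ∃ l, D.toV l ∈ D.L ∧ pairTR hD l = ρ := by
  constructor
  · intro h
    obtain ⟨w, rfl⟩ := hD.isOfFrobenius_VT.dualEquiv.surjective ρ
    have hw := hD.hmul_eq_iff_phiR_phiB_eq.mp ((hD.isOfFrobenius_VT.isLeftIntegralOn_iff w).mp h)
    refine ⟨D.phiL (D.phiB (D.toH.symm w)), ⟨_, rfl⟩, ?_⟩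
    rw [← hD.dualEquiv_VT ⟨_, rfl⟩, phiBLB]
    exact congrArg _ hw
  · rintro ⟨l, hl, rfl⟩
    rw [← hD.dualEquiv_VT hl, hD.isOfFrobenius_VT.isLeftIntegralOn_iff]
    exact hD.hmul_eq_iff_phiR_phiB_eq.mpr (congrArg D.phiR (D.phiBRB l))

/-- This is the twisting criterion for `Φ_B Φ_L` on `V`; commutation with the image of `B`, which
lies in `L`, is automatic for `r ∈ R`. -/
theorem isFrobeniusHom_pairBL_iff {r : A} (hr : D.toV r ∈ D.R) :
    IsFrobeniusHom (k := k) (VB hD).s (pairBL hD r).1 ↔ IsUnit (D.toV r) := by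
  rw [pairBL_eq_comp]
  refine (hD.frobBL.comp_mulRight_iff (D.toV r)).trans (and_iff_right ?_)
  obtain ⟨c, rfl⟩ := hr
  exact fun b => (D.vmul_comm_LR _ c).symm

theorem isFrobeniusHom_pairTR_iff {l : A} (hl : D.toV l ∈ D.L) :
    IsFrobeniusHom (k := k) (VT hD).s (pairTR hD l).1 ↔ IsUnit (D.toV l) := by
  rw [pairTR_eq_comp]
  refine (hD.frobTR.comp_mulLeft_iff (D.toV l)).trans (and_iff_right ?_)
  obtain ⟨c, rfl⟩ := hl
  exact fun b => D.vmul_comm_LR c _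

theorem bijOn_pairBL :
    Set.BijOn (pairBL hD) D.Rcirc {ρ | (VB hD).IsFrobeniusRightIntegralOn ρ} := by
  refine ⟨fun r hr => ⟨(hD.isRightIntegralOn_VB_iff _).mpr ⟨r, hr.1, rfl⟩,
    (hD.isFrobeniusHom_pairBL_iff hr.1).mpr hr.2⟩, hD.pairBL_injective.injOn, ?_⟩
  rintro ρ ⟨h1, h2⟩
  obtain ⟨r, hr, rfl⟩ := (hD.isRightIntegralOn_VB_iff ρ).mp h1
  exact ⟨r, ⟨hr, (hD.isFrobeniusHom_pairBL_iff hr).mp h2⟩, rfl⟩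

theorem bijOn_pairTR :
    Set.BijOn (pairTR hD) D.Lcirc {ρ | (VT hD).IsFrobeniusLeftIntegralOn ρ} := by
  refine ⟨fun l hl => ⟨(hD.isLeftIntegralOn_VT_iff _).mpr ⟨l, hl.1, rfl⟩,
    (hD.isFrobeniusHom_pairTR_iff hl.1).mpr hl.2⟩, hD.pairTR_injective.injOn, ?_⟩
  rintro ρ ⟨h1, h2⟩
  obtain ⟨l, hl, rfl⟩ := (hD.isLeftIntegralOn_VT_iff ρ).mp h1
  exact ⟨l, ⟨hl, (hD.isFrobeniusHom_pairTR_iff hl).mp h2⟩, rfl⟩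

/-! ### Duality of integrals -/

/-- Since `Φ_B(a) = Φ_B Φ_L(a ∘ i)`, the duality condition compares `x ∘ r` with `i` under a
nondegenerate functional. Thus `x ∘ r = i`, that is, `x = i ∘ r⁻¹`. -/
theorem isDualLeftIntegral_pairBL_iff {r : A} (hr : IsUnit (D.toV r)) (x : A) :
    (VB hD).IsDualLeftIntegral (pairBL hD r) (D.toV x) ↔ x = D.phiT (D.vinv r) := by
  have hx : x = D.phiT (D.vinv r) ↔ D.toV x * D.toV r = D.toV D.i :=
    Ring.eq_mul_inverse_iff_mul_eq (D.toV x) (D.toV D.i) (D.toV r) hr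
  have hi : ∀ a, D.PhiBL (a * D.toV D.i) = (VB hD).coring.counit a := fun a =>
    Subtype.ext (D.phiBLB _)
  rw [hx]
  constructor
  · intro h
    refine hD.frobBL.ext_right fun a => ?_
    rw [hi, ← h, pairBL_eq_comp, ← mul_assoc]
    rfl
  · intro h a
    rw [pairBL_eq_comp, ← hi, ← h, ← mul_assoc]
    rfl

theorem isDualRightIntegral_pairTR_iff {l : A} (hl : IsUnit (D.toV l)) (x : A) :
    (VT hD).IsDualRightIntegral (pairTR hD l) (D.toV x) ↔ x = D.phiB (D.vinv l) := by
  have hx : x = D.phiB (D.vinv l) ↔ D.toV l * D.toV x = D.toV D.i :=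
    eq_comm.trans ((Ring.inverse_mul_eq_iff_eq_mul (D.toV l) (D.toV D.i) (D.toV x) hl).trans
      eq_comm)
  have hi : ∀ a, D.PhiTR (D.toV D.i * a) = (VT hD).coring.counit a := fun a =>
    Subtype.ext (D.phiTRT _)
  rw [hx]
  constructor
  · intro h
    refine hD.frobTR.ext_left fun a => ?_
    rw [hi, ← h, pairTR_eq_comp, mul_assoc]
    rfl
  · intro h a
    rw [pairTR_eq_comp, ← hi, ← h, mul_assoc]
    rfl

/-- For `ρ` corresponding to `w ∈ H`, duality reads `t ⋆ w = e`, so `w = Φ_L(t⁻¹)`. Since `t⁻¹ ∈ T`,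
this equals `Φ_L Φ_T(r)` with `r = Φ_R(t⁻¹)`. -/
theorem isDualRightIntegral_VB_iff {t : A} (ht : t ∈ D.Tstar) (ρ : (VB hD).rightDual) :
    (VB hD).IsDualRightIntegral (D.toV t) ρ ↔ ρ = pairBL hD (D.phiR (D.hinv t)) := by
  obtain ⟨w, rfl⟩ := hD.isOfFrobenius_VB.dualEquiv.surjective ρ
  have hinv : D.phiT (D.phiR (D.hinv t)) = D.hinv t := by
    obtain ⟨c, hc⟩ := hD.hinv_mem_T ht.1
    rw [← D.toH.injective hc, phiTRT]
  rw [← hD.dualEquiv_VB ⟨_, rfl⟩, hinv, EmbeddingLike.apply_eq_iff_eq,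
    hD.isOfFrobenius_VB.isDualRightIntegral_iff]
  exact eq_comm.trans
    ((Ring.inverse_mul_eq_iff_eq_mul (D.toH t) (D.toH D.e) w ht.2).symm.trans eq_comm)

theorem isDualLeftIntegral_VT_iff {b : A} (hb : b ∈ D.Bstar) (ρ : (VT hD).leftDual) :
    (VT hD).IsDualLeftIntegral (D.toV b) ρ ↔ ρ = pairTR hD (D.phiL (D.hinv b)) := by
  obtain ⟨w, rfl⟩ := hD.isOfFrobenius_VT.dualEquiv.surjective ρ
  have hinv : D.phiB (D.phiL (D.hinv b)) = D.hinv b := by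
    obtain ⟨c, hc⟩ := hD.hinv_mem_B hb.1
    rw [← D.toH.injective hc, phiBLB]
  rw [← hD.dualEquiv_VT ⟨_, rfl⟩, hinv, EmbeddingLike.apply_eq_iff_eq,
    hD.isOfFrobenius_VT.isDualLeftIntegral_iff]
  exact (Ring.eq_mul_inverse_iff_mul_eq w (D.toH D.e) (D.toH b) hb.2).symm

end IsFrobenius

end DoubleAlgebra

end

/-! ### Frobenius integrals of a Frobenius double algebra and their duality. -/

theorem mainTheorem9 {k A : Type*} [CommRing k] [AddCommGroup A] [Module k A]
    (D : DoubleAlgebra k A) (hD : D.IsFrobenius) :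
    (∀ x : A, (DoubleAlgebra.VB hD).IsFrobeniusLeftIntegral (D.toV x) ↔ x ∈ D.Tstar) ∧
    (∀ x : A, (DoubleAlgebra.VT hD).IsFrobeniusRightIntegral (D.toV x) ↔ x ∈ D.Bstar) ∧
    (∀ x : A, (DoubleAlgebra.HL hD).IsFrobeniusLeftIntegral (D.toH x) ↔ x ∈ D.Rcirc) ∧
    (∀ x : A, (DoubleAlgebra.HR hD).IsFrobeniusRightIntegral (D.toH x) ↔ x ∈ D.Lcirc) ∧
    ((∃ S : A →ₗ[k] A, D.IsAntipode S) →
      -- `T_⋆` and `R_∘`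
      (Set.BijOn (fun t => D.phiR (D.hinv t)) D.Tstar D.Rcirc ∧
        Set.BijOn (fun r => D.phiT (D.vinv r)) D.Rcirc D.Tstar ∧
        Set.InvOn (fun r => D.phiT (D.vinv r)) (fun t => D.phiR (D.hinv t)) D.Tstar D.Rcirc ∧
        Set.BijOn (DoubleAlgebra.pairBL hD) D.Rcirc
          {ρ | (DoubleAlgebra.VB hD).IsFrobeniusRightIntegralOn ρ} ∧
        (∀ r ∈ D.Rcirc, ∀ x : A,
          (DoubleAlgebra.VB hD).IsDualLeftIntegral (DoubleAlgebra.pairBL hD r) (D.toV x) ↔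
            x = D.phiT (D.vinv r)) ∧
        (∀ t ∈ D.Tstar, ∀ ρ : (DoubleAlgebra.VB hD).rightDual,
          (DoubleAlgebra.VB hD).IsDualRightIntegral (D.toV t) ρ ↔
            ρ = DoubleAlgebra.pairBL hD (D.phiR (D.hinv t)))) ∧
      -- `B_⋆` and `L_∘`
      (Set.BijOn (fun b => D.phiL (D.hinv b)) D.Bstar D.Lcirc ∧
        Set.BijOn (fun l => D.phiB (D.vinv l)) D.Lcirc D.Bstar ∧
        Set.InvOn (fun l => D.phiB (D.vinv l)) (fun b => D.phiL (D.hinv b)) D.Bstar D.Lcirc ∧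
        Set.BijOn (DoubleAlgebra.pairTR hD) D.Lcirc
          {ρ | (DoubleAlgebra.VT hD).IsFrobeniusLeftIntegralOn ρ} ∧
        (∀ l ∈ D.Lcirc, ∀ x : A,
          (DoubleAlgebra.VT hD).IsDualRightIntegral (DoubleAlgebra.pairTR hD l) (D.toV x) ↔
            x = D.phiB (D.vinv l)) ∧
        (∀ b ∈ D.Bstar, ∀ ρ : (DoubleAlgebra.VT hD).leftDual,
          (DoubleAlgebra.VT hD).IsDualLeftIntegral (D.toV b) ρ ↔
            ρ = DoubleAlgebra.pairTR hD (D.phiL (D.hinv b))))) := by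

  refine ⟨hD.isFrobeniusLeftIntegral_VB_iff, hD.isFrobeniusRightIntegral_VT_iff,
    hD.isFrobeniusLeftIntegral_HL_iff, hD.isFrobeniusRightIntegral_HR_iff, fun _ =>
    ⟨⟨?_, ?_, hD.invOn_Tstar_Rcirc, hD.bijOn_pairBL,
      fun r hr => hD.isDualLeftIntegral_pairBL_iff hr.2,
      fun t ht => hD.isDualRightIntegral_VB_iff ht⟩,
    ⟨?_, ?_, hD.invOn_Bstar_Lcirc, hD.bijOn_pairTR,
      fun l hl => hD.isDualRightIntegral_pairTR_iff hl.2,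
      fun b hb => hD.isDualLeftIntegral_VT_iff hb⟩⟩⟩
  · exact hD.invOn_Tstar_Rcirc.bijOn (fun t ht => (hD.phiR_hinv ht).1)
      fun r hr => (hD.phiT_vinv hr).1
  · exact hD.invOn_Tstar_Rcirc.symm.bijOn (fun r hr => (hD.phiT_vinv hr).1)
      fun t ht => (hD.phiR_hinv ht).1
  · exact hD.invOn_Bstar_Lcirc.bijOn (fun b hb => (hD.phiL_hinv hb).1)
      fun l hl => (hD.phiB_vinv hl).1
  · exact hD.invOn_Bstar_Lcirc.symm.bijOn (fun l hl => (hD.phiB_vinv hl).1)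
      fun b hb => (hD.phiL_hinv hb).1
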